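/- **Theorem 4.1.** Let $d\ge 1$ and let $(X_t)_{t\in\mathbb Z}$ be a strictly stationary sequence of $\mathbb R^d$-valued random vectors ($|\cdot|$ is the Euclidean norm). Write $M_{s,t}=\max_{s\le i\le t}|X_i|$. Let $E=[-\infty,\infty]^d\setminus\{0\}$, let $\mathbb C_K^+$ be the set of non-negative continuous functions on $E$ with compact support (with $g(0):=0$ for $g\in\mathbb C_K^+$), and let the space of point measures on $E$ (integer-valued measures, finite on compact sets) carry the vague topology. Let $(a_n)$ be a real sequence with $n\,\mathbb P(|X_0|>a_n)\to1$, let $(m_n)$ be a sequence of non-negative integers with $m_n\to\infty$ and $m_n/n\to0$, put $k_n=[n/m_n]$, and $$N_{nj}=\sum_{t=1}^{j}\varepsilon_{a_n^{-1}X_t}\quad(\text{on } E),\qquad N_n=N_{nn}.$$ Assume that 1. (regular variation) for some $\alpha>0$, every vector $Z=(X_1,\dots,X_k)$, $k\ge1$, is regularly varying with index $\alpha$: there is a probability measure $\sigma_k$ on the unit sphere of $\mathbb R^{dk}$ such that for each $u>0$, $\mathbb P(|Z|>ux,\,Z/|Z|\in\cdot\,)/\mathbb P(|Z|>x)$ converges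 weakly to $u^{-\alpha}\sigma_k$ as $x\to\infty$; 2. (mixing condition $\mathcal A(a_n)$) $\mathbb E e^{-\int f\,dN_n}-\big(\mathbb E e^{-\int f\,dN_{n,m_n}}\big)^{k_n}\to0$ for every $f\in\mathbb C_K^+$; 3. (anti-clustering) $\displaystyle\lim_{k\to\infty}\limsup_{n\to\infty}\mathbb P\big(M_{k,m_n}>\delta a_n\,\big|\,|X_0|>\delta a_n\big)=0$ for every $\delta>0$. Then $(X_t)$ has a spectral tail process, that is, an $\mathbb R^d$-valued process $(\Theta_t)_{t\in\mathbb Z}$ such that for every $k\ge0$ the law of $|X_0|^{-1}(X_{-k},\dots,X_k)$ given $|X_0|>x$ converges weakly to the law of $(\Theta_{-k},\dots,\Theta_k)$ as $x\to\infty$; and there is a point process $N$ on $E$ such that $N_n\stackrel{d}{\to}N$ (weak convergence of the laws on the space of point measures with the vague topology) and, for every $g\in\mathbb C_K^+$, $$\mathbb E\,e^{-\int_E g\,dN}=\exp\Big(-\int_0^\infty\mathbb E\Big(e^{-\sum_{j\ge1}g(y\Theta_j)}-e^{-\sum_{j\ge0}g(y\Theta_j)}\Big)\,d(-y^{-\alpha})\Big),$$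 where the integral with respect to $d(-y^{-\alpha})=\alpha y^{-\alpha-1}\,dy$ converges absolutely. -/

import Mathlib

open MeasureTheory ProbabilityTheory Filter Topology Set
open scoped NNReal ENNReal BoundedContinuousFunction CompactlySupported

noncomputable section

namespace HeavyTail

/-! ### Point measures and the vague topology -/

/-- Point measures on `E`: integer-valued measures which are finite on compact sets. -/
def PointMeasure (E : Type*) [TopologicalSpace E] [MeasurableSpace E] : Type _ :=
  {μ : Measure E // (∀ K, IsCompact K → μ K < ∞) ∧
    ∀ B, MeasurableSet B → ∃ k : ℕ∞, μ B = (k : ℝ≥0∞)}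

section PointMeasure

variable {E : Type*} [TopologicalSpace E] [MeasurableSpace E]

/-- The integral `∫ g dN` of a non-negative continuous function with compact support. -/
def PointMeasure.integral (N : PointMeasure E) (g : C_c(E, ℝ≥0)) : ℝ≥0∞ :=
  ∫⁻ x, (g x : ℝ≥0∞) ∂N.1

/-- The vague topology: the coarsest topology for which `N ↦ ∫ g dN` is continuous for every
non-negative continuous `g` with compact support. -/
instance : TopologicalSpace (PointMeasure E) :=
  TopologicalSpace.induced (fun N (g : C_c(E, ℝ≥0)) => N.integral g) inferInstance

instance : MeasurableSpace (PointMeasure E) := borel _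

instance : BorelSpace (PointMeasure E) := ⟨rfl⟩

/-- The null measure. -/
instance : Zero (PointMeasure E) := ⟨⟨0, fun _ _ => by simp, fun _ _ => ⟨0, by simp⟩⟩⟩

/-- Superposition. -/
instance : Add (PointMeasure E) :=
  ⟨fun M N => ⟨M.1 + N.1, fun K hK => by
      simpa using ⟨M.2.1 K hK, N.2.1 K hK⟩, fun B hB => by
      obtain ⟨k, hk⟩ := M.2.2 B hB
      obtain ⟨l, hl⟩ := N.2.2 B hB
      exact ⟨k + l, by simp [hk, hl]⟩⟩⟩

theorem PointMeasure.coe_zero : (0 : PointMeasure E).1 = 0 := rfl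

theorem PointMeasure.coe_add (M N : PointMeasure E) : (M + N).1 = M.1 + N.1 := rfl

instance : AddCommMonoid (PointMeasure E) where
  add_assoc _ _ _ := Subtype.ext (add_assoc _ _ _)
  zero_add _ := Subtype.ext (zero_add _)
  add_zero _ := Subtype.ext (add_zero _)
  add_comm _ _ := Subtype.ext (add_comm _ _)
  nsmul := nsmulRec

/-- The unit point mass `ε_x`. -/
def PointMeasure.dirac (x : E) : PointMeasure E :=
  ⟨Measure.dirac x, fun _ _ => measure_lt_top _ _, fun B hB => by
    classical
    by_cases hx : x ∈ B
    · exact ⟨1, by simp [Measure.dirac_apply' x hB, hx]⟩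
    · exact ⟨0, by simp [Measure.dirac_apply' x hB, hx]⟩⟩

end PointMeasure

/-! ### The state space `[-∞, ∞]^d \ {0}` -/

/-- The space `[-∞, ∞]^d \ {0}`, with the topology and the Borel sets of a subspace of
`[-∞, ∞]^d`. -/
abbrev Punctured (d : ℕ) : Type := {x : Fin d → EReal // x ≠ 0}

/-- The inclusion of `ℝ^d` in `[-∞, ∞]^d`. -/
def extend {d : ℕ} (x : EuclideanSpace ℝ (Fin d)) : Fin d → EReal := fun i => ((x i : ℝ) : EReal)

open Classical in
/-- The value at `x ∈ ℝ^d` of a function on `[-∞, ∞]^d \ {0}` with compact support, which is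
extended by `0` to the origin. -/
def evalAt {d : ℕ} (g : C_c(Punctured d, ℝ≥0)) (x : EuclideanSpace ℝ (Fin d)) : ℝ≥0 :=
  if h : extend x ≠ 0 then g ⟨extend x, h⟩ else 0

open Classical in
/-- The point mass at `x ∈ ℝ^d` as a point measure on `[-∞, ∞]^d \ {0}`; a point at the origin is
not in the state space and does not count. -/
def pointMass {d : ℕ} (x : EuclideanSpace ℝ (Fin d)) : PointMeasure (Punctured d) :=
  if h : extend x ≠ 0 then PointMeasure.dirac ⟨extend x, h⟩ else 0

/-! ### Stationary regularly varying sequences -/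

section Sequences

variable {Ω : Type*} [MeasurableSpace Ω]

/-- Strict stationarity: the law of the whole sequence is invariant under time shifts. -/
def StrictlyStationary {V : Type*} [MeasurableSpace V] (P : Measure Ω) (X : ℤ → Ω → V) : Prop :=
  ∀ h : ℤ, P.map (fun ω t => X (t + h) ω) = P.map (fun ω t => X t ω)

/-- Regular variation with index `α` of a random vector `Z`: there is a probability measure `σ`
on the unit sphere such that, for every `u > 0`,
`P(|Z| > u x, Z / |Z| ∈ ·) / P(|Z| > x)` converges weakly to `u ^ (-α) σ` as `x → ∞`. -/
def RegularlyVarying {V : Type*} [NormedAddCommGroup V] [NormedSpace ℝ V] [MeasurableSpace V]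
    (P : Measure Ω) (α : ℝ) (Z : Ω → V) : Prop :=
  ∃ σ : Measure V, IsProbabilityMeasure σ ∧ σ (Metric.sphere 0 1) = 1 ∧
    ∀ u : ℝ, 0 < u → ∀ f : V →ᵇ ℝ,
      Tendsto (fun x : ℝ => (∫ ω in {ω | u * x < ‖Z ω‖}, f (‖Z ω‖⁻¹ • Z ω) ∂P) /
        P.real {ω | x < ‖Z ω‖}) atTop (𝓝 (u ^ (-α) * ∫ θ, f θ ∂σ))

variable {d : ℕ}

/-- Regular variation with index `α` of a sequence: every lagged vector `(X_1, …, X_k)`, a random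
vector in `ℝ^(k d)` with its Euclidean norm, is regularly varying with index `α`. -/
def RegularlyVaryingSeq (P : Measure Ω) (α : ℝ) (X : ℤ → Ω → EuclideanSpace ℝ (Fin d)) : Prop :=
  ∀ k : ℕ, 1 ≤ k → RegularlyVarying P α (V := PiLp 2 fun _ : Fin k => EuclideanSpace ℝ (Fin d))
    (fun ω => WithLp.toLp 2 fun i : Fin k => X ((i : ℤ) + 1) ω)

/-- `Q` is the law of the spectral tail process `(Θ_t)` of `(X_t)`: for every `k`, the law of
`|X_0|⁻¹ (X_{-k}, …, X_k)` given `|X_0| > x` converges weakly to the law of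
`(Θ_{-k}, …, Θ_k)` as `x → ∞`. -/
def IsSpectralTailLaw (P : Measure Ω) (X : ℤ → Ω → EuclideanSpace ℝ (Fin d))
    (Q : Measure (ℤ → EuclideanSpace ℝ (Fin d))) : Prop :=
  IsProbabilityMeasure Q ∧
    ∀ k : ℕ, ∀ f : (Finset.Icc (-(k : ℤ)) k → EuclideanSpace ℝ (Fin d)) →ᵇ ℝ,
      Tendsto (fun x : ℝ => ∫ ω, f (fun t => ‖X 0 ω‖⁻¹ • X t ω) ∂(P[|{ω | x < ‖X 0 ω‖}])) atTop
        (𝓝 (∫ θ, f (fun t => θ t) ∂Q))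

/-- `M_{s,t} = max_{s ≤ i ≤ t} |X_i|`. -/
def maxNorm (X : ℤ → Ω → EuclideanSpace ℝ (Fin d)) (s t : ℤ) (ω : Ω) : ℝ≥0 :=
  (Finset.Icc s t).sup fun i => ‖X i ω‖₊

/-- The anti-clustering condition at the levels `δ a_n` over the time horizon `m_n`:
`lim_k limsup_n P(M_{k,m_n} > δ a_n | |X_0| > δ a_n) = 0` for every `δ > 0`. -/
def AntiClustering (P : Measure Ω) (X : ℤ → Ω → EuclideanSpace ℝ (Fin d)) (a : ℕ → ℝ)
    (m : ℕ → ℕ) : Prop :=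
  ∀ δ : ℝ, 0 < δ → Tendsto (fun k : ℕ => limsup (fun n : ℕ =>
    (P[|{ω | δ * a n < ‖X 0 ω‖}]) {ω | δ * a n < maxNorm X k (m n) ω}) atTop) atTop (𝓝 0)

/-- The point process `∑_{t=1}^j ε_{X_t / c}`. With `c = a_n` this is `N_{nj}`. -/
def pointProcess (X : ℤ → Ω → EuclideanSpace ℝ (Fin d)) (c : ℝ) (j : ℕ) (ω : Ω) :
    PointMeasure (Punctured d) :=
  ∑ t ∈ Finset.Icc 1 j, pointMass (c⁻¹ • X (t : ℤ) ω)

/-- The Laplace functional `E exp(-∫ g dN)` of a point process `N`. -/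
def laplace {E : Type*} [TopologicalSpace E] [MeasurableSpace E] (P : Measure Ω)
    (N : Ω → PointMeasure E) (g : C_c(E, ℝ≥0)) : ℝ :=
  ∫ ω, Real.exp (-((N ω).integral g).toReal) ∂P

/-- The mixing condition: `E e^{-∫ g dN_n} - (E e^{-∫ g dN_{n,m_n}})^{k_n} → 0` with
`k_n = [n / m_n]`, for every non-negative continuous `g` with compact support. -/
def MixingCondition (P : Measure Ω) (X : ℤ → Ω → EuclideanSpace ℝ (Fin d)) (a : ℕ → ℝ)
    (m : ℕ → ℕ) : Prop :=
  ∀ g : C_c(Punctured d, ℝ≥0), Tendsto (fun n : ℕ =>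
    laplace P (pointProcess X (a n) n) g - laplace P (pointProcess X (a n) (m n)) g ^ (n / m n))
    atTop (𝓝 0)

end Sequences

/-! ### The limiting Laplace functional -/

/-- `e^{-s}` for `s ∈ [0, ∞]`, with `e^{-∞} = 0`. -/
def expNeg (s : ℝ≥0∞) : ℝ := if s = ∞ then 0 else Real.exp (-s.toReal)

variable {d : ℕ}

/-- `y ↦ E(e^{-∑_{j ≥ 1} g(y Θ_j)} - e^{-∑_{j ≥ 0} g(y Θ_j)}) α y^{-α-1}`, the integrand for
`d(-y^{-α}) = α y^{-α-1} dy`. -/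
def clusterIntegrand (α : ℝ) (Q : Measure (ℤ → EuclideanSpace ℝ (Fin d)))
    (g : C_c(Punctured d, ℝ≥0)) (y : ℝ) : ℝ :=
  (∫ θ, (expNeg (∑' j : ℕ, (evalAt g (y • θ ((j : ℤ) + 1)) : ℝ≥0∞)) -
    expNeg (∑' j : ℕ, (evalAt g (y • θ (j : ℤ)) : ℝ≥0∞))) ∂Q) * (α * y ^ (-α - 1))

end HeavyTail

end

open HeavyTail

/-!
The Laplace functional of a block of length `m` telescopes. With `γ = g (· / a_n)`, removing the
variables one at a time and shifting by stationarity gives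
`1 - E e^{-∑_{j ≤ m} γ(X_j)} = ∑_{l < m} E (e^{-∑_{1 ≤ j ≤ l} γ(X_j)} - e^{-∑_{0 ≤ j ≤ l} γ(X_j)})`
(`StrictlyStationary.one_sub_integral_exp_eq_sum`). A summand only sees the event `|X_0| > δ a_n`,
because `g` vanishes on the ball of radius `δ`, and by anti-clustering the summand for large `l` may
be replaced by the one for a fixed lag `k`, up to an error which is negligible when first `n → ∞`
and then `k → ∞` (`StrictlyStationary.abs_one_sub_integral_exp_sub_le`). Given `|X_0| > x`, the pair
consisting of `|X_0| / x` and `X / |X_0|` converges in law to a Pareto variable and an independent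
spectral tail process, so `k_n (1 - E e^{-∫ g dN_{n,m_n}})` converges to
`∫ E(e^{-∑_{j ≥ 1} g(yΘ_j)} - e^{-∑_{j ≥ 0} g(yΘ_j)}) d(-y^{-α})`
(`tendsto_mul_one_sub_block`, `rpow_mul_integral_clusterDiff`), and the mixing condition turns this
into the convergence of the Laplace functionals of `N_n` (`IsSpectralTailLaw.tendsto_laplace`).

The joint limit rests on two facts. The radial part is handled by
`tendsto_of_forall_setIntegral_tendsto`: convergence of `E(f(S); R > u)` for all `u ≥ 1` and all
bounded continuous `f` determines the limit of the law of `(R, S)`. The spectral tail process comes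
from `exists_isSpectralTailLaw`: regular variation of the block `(X_1, …, X_{2k+1})`, whose centre
plays the role of `X_0`, makes the conditional means over the window `[-k, k]` converge, and
Prokhorov's theorem on the path space provides the law of the whole process.

To pass from Laplace functionals to weak convergence on the space of point measures, sets of point
measures on which the integrals of test functions are bounded are shown to be compact
(`isCompact_setOf_integral_le`): an ultrafilter limit is a positive linear functional, hence a
measure by the Riesz representation theorem, and it is again integer-valued. Since the mean
integrals of a test function are bounded in `n`, the laws of `N_n` are tight, and a tight law is
determined by its Laplace functional, because the functions `N ↦ e^{-∫ g dN}` span an algebra which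
separates points (`exists_tendsto_of_tendsto_laplace`). This argument does not use metrizability of
the vague topology.
-/

namespace HeavyTail

/-! ### The vague topology -/

section Vague

variable {E : Type*} [TopologicalSpace E] [MeasurableSpace E]

namespace PointMeasure

theorem continuous_integral (g : C_c(E, ℝ≥0)) :
    Continuous fun N : PointMeasure E => N.integral g := by
  have h : Continuous fun (N : PointMeasure E) (g : C_c(E, ℝ≥0)) => N.integral g :=
    continuous_induced_dom
  exact continuous_pi_iff.1 h g

theorem continuous_iff {Y : Type*} [TopologicalSpace Y] {f : Y → PointMeasure E} :
    Continuous f ↔ ∀ g : C_c(E, ℝ≥0), Continuous fun y => (f y).integral g := by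
  rw [continuous_induced_rng, continuous_pi_iff]
  rfl

theorem tendsto_nhds_iff {ι : Type*} {l : Filter ι} {f : ι → PointMeasure E} {N : PointMeasure E} :
    Tendsto f l (𝓝 N) ↔
      ∀ g : C_c(E, ℝ≥0), Tendsto (fun i => (f i).integral g) l (𝓝 (N.integral g)) := by
  rw [nhds_induced, tendsto_comap_iff, tendsto_pi_nhds]
  rfl

theorem integral_zero (g : C_c(E, ℝ≥0)) : (0 : PointMeasure E).integral g = 0 := by
  simp [integral, coe_zero]

theorem integral_add (M N : PointMeasure E) (g : C_c(E, ℝ≥0)) :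
    (M + N).integral g = M.integral g + N.integral g := by
  simp [integral, coe_add, lintegral_add_measure]

theorem integral_sum {ι : Type*} (s : Finset ι) (N : ι → PointMeasure E) (g : C_c(E, ℝ≥0)) :
    (∑ i ∈ s, N i).integral g = ∑ i ∈ s, (N i).integral g := by
  classical
  induction s using Finset.induction_on with
  | empty => simp [integral_zero]
  | insert i s hi ih => rw [Finset.sum_insert hi, Finset.sum_insert hi, integral_add, ih]

theorem integral_mono (N : PointMeasure E) {g h : C_c(E, ℝ≥0)} (H : ∀ x, g x ≤ h x) :
    N.integral g ≤ N.integral h :=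
  lintegral_mono fun x => ENNReal.coe_le_coe.2 (H x)

variable [BorelSpace E]

theorem integral_dirac (x : E) (g : C_c(E, ℝ≥0)) : (dirac x).integral g = g x :=
  lintegral_dirac' x (f := fun y => (g y : ℝ≥0∞)) g.continuous.measurable.coe_nnreal_ennreal

theorem integral_ne_top (N : PointMeasure E) (g : C_c(E, ℝ≥0)) : N.integral g ≠ ∞ := by
  have : IsFiniteMeasureOnCompacts N.1 := ⟨N.2.1⟩
  have h : Integrable (fun x => (g x : ℝ)) N.1 :=
    Continuous.integrable_of_hasCompactSupport (by fun_prop)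
      (HasCompactSupport.comp_left g.hasCompactSupport rfl)
  have := h.lintegral_lt_top
  simp only [ENNReal.ofReal_coe_nnreal] at this
  exact this.ne

theorem integral_test_add (N : PointMeasure E) (g h : C_c(E, ℝ≥0)) :
    N.integral (g + h) = N.integral g + N.integral h := by
  simp only [integral, CompactlySupportedContinuousMap.coe_add, Pi.add_apply, ENNReal.coe_add]
  exact lintegral_add_left g.continuous.measurable.coe_nnreal_ennreal _

theorem integral_test_smul (N : PointMeasure E) (c : ℝ≥0) (g : C_c(E, ℝ≥0)) :
    N.integral (c • g) = c * N.integral g := by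
  simp only [integral, CompactlySupportedContinuousMap.coe_smul, Pi.smul_apply, smul_eq_mul,
    ENNReal.coe_mul]
  exact lintegral_const_mul _ g.continuous.measurable.coe_nnreal_ennreal

theorem continuous_integral_toReal (g : C_c(E, ℝ≥0)) :
    Continuous fun N : PointMeasure E => (N.integral g).toReal :=
  ENNReal.continuousOn_toReal.comp_continuous (continuous_integral g) fun N => N.integral_ne_top g

end PointMeasure

end Vague

/-! ### Compact sets of point measures -/

section Regular

/-- A compactly supported bump: equal to one on a compact set, at most one everywhere, and
supported in a prescribed neighbourhood. -/
theorem exists_bump {E : Type*} [TopologicalSpace E] [T2Space E] [LocallyCompactSpace E]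
    {K U : Set E} (hK : IsCompact K) (hU : IsOpen U) (hKU : K ⊆ U) :
    ∃ g : C_c(E, ℝ≥0), (∀ x ∈ K, g x = 1) ∧ (∀ x, g x ≤ 1) ∧ ∀ x, x ∉ U → g x = 0 := by
  obtain ⟨f, h1, h0, hc, h01⟩ := exists_continuous_one_zero_of_isCompact hK hU.isClosed_compl
    (disjoint_compl_right_iff_subset.2 hKU)
  refine ⟨⟨⟨fun x => (f x).toNNReal, by fun_prop⟩, ?_⟩, fun x hx => ?_, fun x => ?_, fun x hx => ?_⟩
  · exact HasCompactSupport.comp_left hc (g := Real.toNNReal) (by simp)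
  · simp [h1 hx]
  · simpa using (h01 x).2
  · simp [h0 (show x ∈ Uᶜ from hx)]

/-- A sequence of test functions which dominates every test function up to constants. -/
theorem exists_dominating_seq (E : Type*) [TopologicalSpace E] [T2Space E] [LocallyCompactSpace E]
    [SecondCountableTopology E] :
    ∃ χ : ℕ → C_c(E, ℝ≥0), ∀ g : C_c(E, ℝ≥0), ∃ (i : ℕ) (C : ℝ≥0), ∀ x, g x ≤ C * χ i x := by
  let K := CompactExhaustion.choice E
  choose χ h1 _ _ using fun n => exists_bump (K.isCompact n) isOpen_univ (subset_univ _)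
  refine ⟨χ, fun g => ?_⟩
  obtain ⟨i, hi⟩ := K.exists_superset_of_isCompact g.hasCompactSupport.isCompact
  obtain ⟨C, hC⟩ := (g.hasCompactSupport.isCompact_range g.continuous).bddAbove
  refine ⟨i, C, fun x => ?_⟩
  by_cases hx : x ∈ tsupport g
  · rw [h1 i x (hi hx), mul_one]
    exact hC ⟨x, rfl⟩
  · simp [image_eq_zero_of_notMem_tsupport hx]

variable {E : Type*} [TopologicalSpace E] [T2Space E] [LocallyCompactSpace E]
  [SecondCountableTopology E] [MeasurableSpace E] [BorelSpace E]

theorem regular_of_isFiniteMeasureOnCompacts (μ : Measure E) [IsFiniteMeasureOnCompacts μ] :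
    μ.Regular := by
  have := TopologicalSpace.metrizableSpace_of_t3_secondCountable E
  infer_instance

instance : T2Space (PointMeasure E) := by
  refine T2Space.of_injective_continuous
    (f := fun (N : PointMeasure E) (g : C_c(E, ℝ≥0)) => N.integral g) ?_ continuous_induced_dom
  intro M N h
  have : IsFiniteMeasureOnCompacts M.1 := ⟨M.2.1⟩
  have : IsFiniteMeasureOnCompacts N.1 := ⟨N.2.1⟩
  have := regular_of_isFiniteMeasureOnCompacts M.1
  have := regular_of_isFiniteMeasureOnCompacts N.1
  refine Subtype.ext (Measure.ext_of_integral_eq_on_compactlySupported_nnreal fun g => ?_)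
  have hg := congrFun h g
  have key : ∀ L : PointMeasure E, ∫ x, (g x : ℝ) ∂L.1 = (L.integral g).toReal := fun L => by
    rw [integral_eq_lintegral_of_nonneg_ae (ae_of_all _ fun x => NNReal.coe_nonneg _)
      (by fun_prop)]
    simp [PointMeasure.integral]
  rw [key, key, show M.integral g = N.integral g from hg]

/-- Vague limits of point measures give compact sets integer mass. If `K` is compact, there are a
compact `L` just above `K` and bumps between `K` and `L` and above `L`; the integers `N(L)` lie
between the integrals of the bumps, which converge to numbers close to `μ(K)`. -/
theorem exists_nat_measure_eq_of_tendsto {ι : Type*} {l : Filter ι} [l.NeBot]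
    {N : ι → PointMeasure E} {μ : Measure E} [μ.Regular]
    (h : ∀ g : C_c(E, ℝ≥0), Tendsto (fun i => (N i).integral g) l (𝓝 (∫⁻ x, g x ∂μ)))
    {K : Set E} (hK : IsCompact K) : ∃ k : ℕ, μ K = k := by
  have hKfin : μ K ≠ ∞ := hK.measure_lt_top.ne
  suffices H : (μ K).toReal ∈ range ((↑) : ℕ → ℝ) by
    obtain ⟨k, hk⟩ := H
    exact ⟨k, by rw [← ENNReal.ofReal_toReal hKfin, ← hk, ENNReal.ofReal_natCast]⟩
  rw [← Nat.isClosedEmbedding_coe_real.isClosed_range.closure_eq, Metric.mem_closure_iff]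
  intro ε hε
  have hε' : ENNReal.ofReal ε ≠ 0 := by simpa using hε
  obtain ⟨U, hKU, hU, hμU⟩ := K.exists_isOpen_lt_add hKfin hε'
  obtain ⟨L, hL, hKL, hLU⟩ := exists_compact_between hK hU hKU
  obtain ⟨f, f1, fle, f0⟩ := exists_bump hK isOpen_interior hKL
  obtain ⟨g, g1, gle, g0⟩ := exists_bump hL hU hLU
  have hμf : μ K ≤ ∫⁻ x, f x ∂μ := by
    rw [← lintegral_indicator_one hK.measurableSet]
    refine lintegral_mono fun x => ?_
    by_cases hx : x ∈ K <;> simp [hx, f1]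
  have hμg : ∫⁻ x, g x ∂μ ≤ μ U := by
    rw [← lintegral_indicator_one hU.measurableSet]
    refine lintegral_mono fun x => ?_
    by_cases hx : x ∈ U <;> simp [hx, g0, gle]
  have hNf : ∀ i, (N i).integral f ≤ (N i).1 L := fun i => by
    rw [PointMeasure.integral, ← lintegral_indicator_one hL.measurableSet]
    refine lintegral_mono fun x => ?_
    by_cases hx : x ∈ L
    · simp [hx, fle]
    · simp [hx, f0 x fun hx' => hx (interior_subset hx')]
  have hNg : ∀ i, (N i).1 L ≤ (N i).integral g := fun i => by
    rw [PointMeasure.integral, ← lintegral_indicator_one hL.measurableSet]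
    refine lintegral_mono fun x => ?_
    by_cases hx : x ∈ L <;> simp [hx, g1]
  have e2 : ∀ᶠ i in l, (N i).integral g < μ K + ENNReal.ofReal ε :=
    (h g).eventually_lt_const (hμg.trans_lt hμU)
  have e1 : ∀ᶠ i in l, μ K < (N i).integral f + ENNReal.ofReal ε := by
    refine ((h f).add_const _).eventually_const_lt ?_
    exact (ENNReal.lt_add_right hKfin hε').trans_le (by gcongr)
  obtain ⟨i, hi1, hi2⟩ := (e1.and e2).exists
  obtain ⟨k, hk⟩ := (N i).2.2 L hL.measurableSet
  have hkfin : (k : ℝ≥0∞) ≠ ∞ := hk ▸ ((N i).2.1 L hL).ne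
  obtain ⟨k, rfl⟩ : ∃ k' : ℕ, (k' : ℕ∞) = k := ENat.ne_top_iff_exists.1 (by simpa using hkfin)
  have h1 : μ K < k + ENNReal.ofReal ε := hi1.trans_le (by gcongr; simpa [hk] using hNf i)
  have h2 : (k : ℝ≥0∞) < μ K + ENNReal.ofReal ε := lt_of_le_of_lt (by simpa [hk] using hNg i) hi2
  refine ⟨k, ⟨k, rfl⟩, ?_⟩
  rw [Real.dist_eq, abs_lt]
  have h1' := (ENNReal.toReal_lt_toReal hKfin (by finiteness)).2 h1
  have h2' := (ENNReal.toReal_lt_toReal (by finiteness) (by finiteness)).2 h2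
  rw [ENNReal.toReal_add (by finiteness) (by finiteness), ENNReal.toReal_ofReal hε.le] at h1' h2'
  simp only [ENNReal.toReal_natCast] at h1' h2'
  constructor <;> linarith

/-- A regular measure is integer-valued as soon as its values on compact sets are integers. -/
theorem exists_enat_measure_eq {μ : Measure E} [μ.Regular]
    (h : ∀ K, IsCompact K → ∃ k : ℕ, μ K = k) {B : Set E} (hB : MeasurableSet B) :
    ∃ k : ℕ∞, μ B = (k : ℝ≥0∞) := by
  choose! k hk using h
  have := TopologicalSpace.metrizableSpace_of_t3_secondCountable E
  rw [hB.measure_eq_iSup_isCompact μ]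
  refine ⟨⨆ (K : Set E) (_ : K ⊆ B) (_ : IsCompact K), (k K : ℕ∞), ?_⟩
  simp only [ENat.toENNReal_iSup]
  refine iSup_congr fun K => iSup_congr fun _ => iSup_congr fun hK => ?_
  rw [hk K hK]
  simp

/-- Bounds on the integrals of a family of test functions which dominates every test function define
a compact set of point measures. A limit along an ultrafilter exists as a positive linear functional
on the test functions, hence as a measure, and this measure is integer-valued. -/
theorem isCompact_setOf_integral_le {ι : Type*} (χ : ι → C_c(E, ℝ≥0)) (c : ι → ℝ≥0)
    (hχ : ∀ g : C_c(E, ℝ≥0), ∃ (i : ι) (C : ℝ≥0), ∀ x, g x ≤ C * χ i x) :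
    IsCompact {N : PointMeasure E | ∀ i, N.integral (χ i) ≤ c i} := by
  refine isCompact_iff_ultrafilter_le_nhds'.2 fun F hF => ?_
  have hlim : ∀ g : C_c(E, ℝ≥0), ∃ b : ℝ≥0,
      Tendsto (fun N : PointMeasure E => N.integral g) F (𝓝 (b : ℝ≥0∞)) := by
    intro g
    obtain ⟨i, C, hC⟩ := hχ g
    have hK : IsCompact (Icc (0 : ℝ≥0∞) (C * c i : ℝ≥0)) := isCompact_Icc
    have hmem : Icc (0 : ℝ≥0∞) (C * c i : ℝ≥0) ∈
        F.map fun N : PointMeasure E => N.integral g := by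
      refine Ultrafilter.mem_map.2 (Filter.mem_of_superset hF fun N hN => ⟨zero_le, ?_⟩)
      calc N.integral g ≤ N.integral (C • χ i) := N.integral_mono hC
        _ = C * N.integral (χ i) := N.integral_test_smul _ _
        _ ≤ (C * c i : ℝ≥0) := by rw [ENNReal.coe_mul]; gcongr; exact hN i
    obtain ⟨b, hb, hb'⟩ := hK.ultrafilter_le_nhds' _ hmem
    lift b to ℝ≥0 using ne_top_of_le_ne_top ENNReal.coe_ne_top hb.2
    exact ⟨b, hb'⟩
  choose Λ hΛ using hlim
  let Λ' : C_c(E, ℝ≥0) →ₗ[ℝ≥0] ℝ≥0 :=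
    { toFun := Λ
      map_add' := fun g h => by
        have := tendsto_nhds_unique (hΛ (g + h))
          (((hΛ g).add (hΛ h)).congr fun N => (N.integral_test_add g h).symm)
        exact_mod_cast this
      map_smul' := fun a g => by
        have := tendsto_nhds_unique (hΛ (a • g))
          ((ENNReal.Tendsto.const_mul (hΛ g) (Or.inr ENNReal.coe_ne_top)).congr
            fun N => (N.integral_test_smul a g).symm)
        rw [← ENNReal.coe_mul, ENNReal.coe_inj] at this
        exact this }
  let μ := NNRealRMK.rieszMeasure Λ'
  have hμ : ∀ g : C_c(E, ℝ≥0), ∫⁻ x, g x ∂μ = Λ g := NNRealRMK.lintegral_rieszMeasure Λ'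
  have hT : ∀ g : C_c(E, ℝ≥0),
      Tendsto (fun N : PointMeasure E => N.integral g) F (𝓝 (∫⁻ x, g x ∂μ)) := fun g => by
    rw [hμ]; exact hΛ g
  let M : PointMeasure E := ⟨μ, fun K hK => hK.measure_lt_top, fun B hB =>
    exists_enat_measure_eq (fun K hK => exists_nat_measure_eq_of_tendsto hT hK) hB⟩
  refine ⟨M, fun i => ?_, ?_⟩
  · exact le_of_tendsto (hT (χ i)) (Filter.mem_of_superset hF fun N hN => hN i)
  · exact PointMeasure.tendsto_nhds_iff.2 hT

end Regular

/-! ### Laplace functionals and weak convergence of point processes -/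

/-- Two tight probability measures which agree on a point-separating algebra of bounded continuous
functions agree on all bounded continuous functions. The space need not be metrizable: on a large
compact set the Stone–Weierstrass theorem applies. -/
theorem integral_eq_of_forall_mem_subalgebra {E : Type*} [TopologicalSpace E] [T2Space E]
    [MeasurableSpace E] [BorelSpace E] {P P' : Measure E} [IsProbabilityMeasure P]
    [IsProbabilityMeasure P']
    (htight : ∀ ε : ℝ≥0, 0 < ε → ∃ K : Set E, IsCompact K ∧ P Kᶜ < ε ∧ P' Kᶜ < ε)
    {A : Subalgebra ℝ (E →ᵇ ℝ)}
    (hA : (A.map (BoundedContinuousFunction.toContinuousMapₐ ℝ)).SeparatesPoints)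
    (heq : ∀ g ∈ A, ∫ x, (g : E → ℝ) x ∂P = ∫ x, (g : E → ℝ) x ∂P') (f : E →ᵇ ℝ) :
    ∫ x, f x ∂P = ∫ x, f x ∂P' := by
  have bound : ∀ ε : ℝ, 0 < ε → |∫ x, Real.mulExpNegMulSq ε (f x) ∂P -
      ∫ x, Real.mulExpNegMulSq ε (f x) ∂P'| ≤ 6 * √ε := by
    intro ε hε
    obtain ⟨K, hK, hP, hP'⟩ := htight ε.toNNReal (by simpa using hε)
    have hKm := hK.measurableSet
    obtain ⟨g', hg'A, hg'⟩ :=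
      ContinuousMap.exists_mem_subalgebra_near_continuous_of_isCompact_of_separatesPoints
        hA f.toContinuousMap hK (Real.sqrt_pos.2 hε)
    obtain ⟨g, hgA, rfl⟩ := Subalgebra.mem_map.1 hg'A
    have near : ∀ (Q : Measure E) [IsProbabilityMeasure Q], Q Kᶜ < ε.toNNReal →
        |∫ x, Real.mulExpNegMulSq ε (f x) ∂Q - ∫ x, Real.mulExpNegMulSq ε (g x) ∂Q| ≤ 3 * √ε := by
      intro Q _ hQ
      have h1 := abs_integral_sub_setIntegral_mulExpNegMulSq_comp_lt f.toContinuousMap hKm hε hQ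
      have h2 := abs_integral_sub_setIntegral_mulExpNegMulSq_comp_lt g.toContinuousMap hKm hε hQ
      have h3 := abs_setIntegral_mulExpNegMulSq_comp_sub_le_mul_measure (P := Q) hK hKm
        f.toContinuousMap g.toContinuousMap hε hg'
      have h4 : √ε * (Q K).toReal ≤ √ε :=
        mul_le_of_le_one_right (Real.sqrt_nonneg _) (measureReal_le_one (μ := Q) (s := K))
      have h3' := h3.trans h4
      rw [abs_le] at *
      rw [abs_lt] at h1 h2
      simp only [BoundedContinuousFunction.coe_toContinuousMap] at h1 h2 h3'
      constructor <;> linarith [h1.1, h1.2, h2.1, h2.2, h3'.1, h3'.2]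
    have n1 := near P hP
    have n2 := near P' hP'
    rw [integral_mulExpNegMulSq_comp_eq hε heq hgA] at n1
    rw [abs_le] at *
    constructor <;> linarith [n1.1, n1.2, n2.1, n2.2]
  have h0 : Tendsto (fun ε : ℝ => 6 * √ε) (𝓝[>] 0) (𝓝 0) := by
    refine tendsto_nhdsWithin_of_tendsto_nhds ?_
    have : Continuous fun ε : ℝ => 6 * √ε := by fun_prop
    simpa using this.tendsto 0
  have lim1 := squeeze_zero' (Eventually.of_forall fun _ => abs_nonneg _)
    (eventually_nhdsWithin_of_forall fun ε (hε : ε ∈ Ioi (0 : ℝ)) => bound ε hε) h0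
  have lim2 := ((tendsto_integral_mulExpNegMulSq_comp (P := P) f).sub
    (tendsto_integral_mulExpNegMulSq_comp (P := P') f)).abs
  exact eq_of_abs_sub_eq_zero (tendsto_nhds_unique lim2 lim1)

section Laplace

variable {E : Type*} [TopologicalSpace E] [MeasurableSpace E] [BorelSpace E]

/-- The bounded continuous function `N ↦ e^{-∫ g dN}` on the space of point measures. -/
noncomputable def expNegIntegral (g : C_c(E, ℝ≥0)) : PointMeasure E →ᵇ ℝ :=
  BoundedContinuousFunction.ofNormedAddCommGroup
    (fun N => Real.exp (-(N.integral g).toReal))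
    (Real.continuous_exp.comp (PointMeasure.continuous_integral_toReal g).neg) 1 fun N => by
      rw [Real.norm_eq_abs, Real.abs_exp, Real.exp_le_one_iff]
      exact neg_nonpos.2 ENNReal.toReal_nonneg

theorem expNegIntegral_apply (g : C_c(E, ℝ≥0)) (N : PointMeasure E) :
    expNegIntegral g N = Real.exp (-(N.integral g).toReal) := rfl

theorem expNegIntegral_zero : expNegIntegral (0 : C_c(E, ℝ≥0)) = 1 := by
  ext N
  simp [expNegIntegral_apply, PointMeasure.integral]

theorem expNegIntegral_add (g h : C_c(E, ℝ≥0)) :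
    expNegIntegral (g + h) = expNegIntegral g * expNegIntegral h := by
  ext N
  rw [BoundedContinuousFunction.mul_apply, expNegIntegral_apply, expNegIntegral_apply,
    expNegIntegral_apply, ← Real.exp_add, PointMeasure.integral_test_add,
    ENNReal.toReal_add (N.integral_ne_top g) (N.integral_ne_top h), neg_add]

/-- The exponentials `N ↦ e^{-∫ g dN}` form a submonoid of the bounded continuous functions. -/
def expNegSubmonoid (E : Type*) [TopologicalSpace E] [MeasurableSpace E] [BorelSpace E] :
    Submonoid (PointMeasure E →ᵇ ℝ) where
  carrier := range expNegIntegral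
  one_mem' := ⟨0, expNegIntegral_zero⟩
  mul_mem' := by
    rintro _ _ ⟨g, rfl⟩ ⟨h, rfl⟩
    exact ⟨g + h, expNegIntegral_add g h⟩

variable [T2Space E] [LocallyCompactSpace E] [SecondCountableTopology E]

theorem exists_integral_ne {M N : PointMeasure E} (h : M ≠ N) :
    ∃ g : C_c(E, ℝ≥0), M.integral g ≠ N.integral g := by
  by_contra! H
  refine h (tendsto_nhds_unique (f := fun _ : Unit => M) (l := ⊤) tendsto_const_nhds ?_)
  exact PointMeasure.tendsto_nhds_iff.2 fun g => by simp [H g]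

/-- The Laplace functional determines a tight law on the space of point measures, as far as
integrals of bounded continuous functions are concerned. -/
theorem integral_eq_of_laplace_eq {P P' : Measure (PointMeasure E)} [IsProbabilityMeasure P]
    [IsProbabilityMeasure P']
    (htight : ∀ ε : ℝ≥0, 0 < ε → ∃ K : Set (PointMeasure E), IsCompact K ∧ P Kᶜ < ε ∧ P' Kᶜ < ε)
    (heq : ∀ g : C_c(E, ℝ≥0), ∫ N, expNegIntegral g N ∂P = ∫ N, expNegIntegral g N ∂P')
    (f : PointMeasure E →ᵇ ℝ) : ∫ N, f N ∂P = ∫ N, f N ∂P' := by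
  refine integral_eq_of_forall_mem_subalgebra htight
    (A := Algebra.adjoin ℝ (expNegSubmonoid E : Set (PointMeasure E →ᵇ ℝ))) ?_ ?_ f
  · intro M N hMN
    obtain ⟨g, hg⟩ := exists_integral_ne hMN
    refine ⟨expNegIntegral g, ⟨(expNegIntegral g).toContinuousMap, ?_, rfl⟩, fun h => hg ?_⟩
    · exact ⟨expNegIntegral g, Algebra.subset_adjoin ⟨g, rfl⟩, rfl⟩
    · have := neg_injective (Real.exp_injective h)
      exact (ENNReal.toReal_eq_toReal_iff' (M.integral_ne_top g) (N.integral_ne_top g)).1 this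
  · intro φ hφ
    have hφ' : φ ∈ Submodule.span ℝ (expNegSubmonoid E : Set (PointMeasure E →ᵇ ℝ)) := by
      rw [← Submonoid.closure_eq (expNegSubmonoid E), ← Algebra.adjoin_eq_span]
      exact hφ
    induction hφ' using Submodule.span_induction with
    | mem x h =>
      obtain ⟨g, rfl⟩ := h
      exact heq g
    | zero => simp
    | add x y _ _ hx hy =>
      have hA : ∀ x ∈ Submodule.span ℝ (expNegSubmonoid E : Set (PointMeasure E →ᵇ ℝ)),
          x ∈ Algebra.adjoin ℝ (expNegSubmonoid E : Set (PointMeasure E →ᵇ ℝ)) := fun x hx =>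
        Algebra.span_le_adjoin _ _ hx
      simp only [BoundedContinuousFunction.add_apply]
      rw [integral_add (x.integrable _) (y.integrable _),
        integral_add (x.integrable _) (y.integrable _), hx (hA x ‹_›), hy (hA y ‹_›)]
    | smul a x _ hx =>
      have hA : x ∈ Algebra.adjoin ℝ (expNegSubmonoid E : Set (PointMeasure E →ᵇ ℝ)) :=
        Algebra.span_le_adjoin _ _ ‹_›
      simp only [BoundedContinuousFunction.smul_apply]
      rw [integral_smul, integral_smul, hx hA]

/-- **Convergence criterion for point processes.** If the mean integrals of every test function are
bounded and the Laplace functionals converge, then the laws converge weakly on the space of point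
measures, and the limits of the Laplace functionals form the Laplace functional of the limit. -/
theorem exists_tendsto_of_tendsto_laplace {μ : ℕ → ProbabilityMeasure (PointMeasure E)}
    {L : C_c(E, ℝ≥0) → ℝ}
    (hb : ∀ g : C_c(E, ℝ≥0), ∃ C : ℝ≥0, ∀ n,
      ∫⁻ N : PointMeasure E, N.integral g ∂(μ n : Measure (PointMeasure E)) ≤ C)
    (hL : ∀ g : C_c(E, ℝ≥0),
      Tendsto (fun n => ∫ N, expNegIntegral g N ∂(μ n : Measure (PointMeasure E))) atTop
        (𝓝 (L g))) :
    ∃ ν : ProbabilityMeasure (PointMeasure E), Tendsto μ atTop (𝓝 ν) ∧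
      ∀ g, ∫ N, expNegIntegral g N ∂(ν : Measure (PointMeasure E)) = L g := by
  obtain ⟨χ, hχ⟩ := exists_dominating_seq E
  choose C hC using hb
  -- By Markov's inequality `{N | c k j ≤ N(χ j)}` has mass at most `2⁻ᵏ 2⁻ʲ⁻¹`, for every `n`.
  let c : ℕ → ℕ → ℝ≥0 := fun k j => (C (χ j) + 1) * 2 ^ (k + (j + 1))
  let K : ℕ → Set (PointMeasure E) := fun k => {N | ∀ j, N.integral (χ j) ≤ c k j}
  let u : ℕ → ℝ≥0 := fun k => 2⁻¹ ^ k
  have hu : Tendsto u atTop (𝓝 0) :=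
    tendsto_pow_atTop_nhds_zero_of_lt_one zero_le (inv_lt_one_of_one_lt₀ one_lt_two)
  have hK : ∀ k, IsCompact (K k) := fun k => isCompact_setOf_integral_le χ (c k) hχ
  have hmono : Monotone K := fun k l hkl N hN j => (hN j).trans <| by
    simp only [c]
    gcongr
    exact one_le_two
  have hT := isCompact_setOfPred_probabilityMeasure_mass_eq_compl_isCompact_le hu hK (Or.inr hmono)
  have hmem : ∀ n, μ n ∈ {ν : ProbabilityMeasure (PointMeasure E) | ∀ k, ν (K k)ᶜ ≤ u k} := by
    intro n k
    have hsub : (K k)ᶜ ⊆ ⋃ j, {N : PointMeasure E | (c k j : ℝ≥0∞) ≤ N.integral (χ j)} := by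
      intro N hN
      obtain ⟨j, hj⟩ := not_forall.1 hN
      exact mem_iUnion.2 ⟨j, (not_le.1 hj).le⟩
    have hj : ∀ j, (μ n : Measure (PointMeasure E)) {N | (c k j : ℝ≥0∞) ≤ N.integral (χ j)} ≤
        2⁻¹ ^ k * 2⁻¹ ^ (j + 1) := by
      intro j
      have hc0 : c k j ≠ 0 := by positivity
      refine (meas_ge_le_lintegral_div
        (PointMeasure.continuous_integral (χ j)).measurable.aemeasurable
        (by exact_mod_cast hc0) ENNReal.coe_ne_top).trans ?_
      refine ENNReal.div_le_of_le_mul ((hC (χ j) n).trans ?_)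
      have : C (χ j) ≤ 2⁻¹ ^ k * 2⁻¹ ^ (j + 1) * c k j := by
        have h1 : (2⁻¹ : ℝ≥0) ^ k * 2⁻¹ ^ (j + 1) * c k j = C (χ j) + 1 := by
          simp only [c]
          rw [← pow_add, inv_pow]
          field_simp
        rw [h1]
        exact le_self_add
      have h2 : ((2⁻¹ : ℝ≥0) : ℝ≥0∞) = 2⁻¹ := by
        rw [ENNReal.coe_inv two_ne_zero]; rfl
      calc (C (χ j) : ℝ≥0∞) ≤ ((2⁻¹ ^ k * 2⁻¹ ^ (j + 1) * c k j : ℝ≥0) : ℝ≥0∞) := by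
            exact_mod_cast this
        _ = 2⁻¹ ^ k * 2⁻¹ ^ (j + 1) * c k j := by
            rw [ENNReal.coe_mul, ENNReal.coe_mul, ENNReal.coe_pow, ENNReal.coe_pow, h2]
    have : (μ n : Measure (PointMeasure E)) (K k)ᶜ ≤ u k := by
      calc (μ n : Measure (PointMeasure E)) (K k)ᶜ
          ≤ ∑' j, (μ n : Measure (PointMeasure E)) {N | (c k j : ℝ≥0∞) ≤ N.integral (χ j)} :=
            (measure_mono hsub).trans (measure_iUnion_le _)
        _ ≤ ∑' j, (2⁻¹ : ℝ≥0∞) ^ k * 2⁻¹ ^ (j + 1) := ENNReal.tsum_le_tsum hj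
        _ = 2⁻¹ ^ k := by
            rw [ENNReal.tsum_mul_left, ENNReal.tsum_geometric_add_one, ENNReal.one_sub_inv_two,
              ENNReal.mul_inv_cancel (by simp) (by simp), mul_one]
        _ = u k := by
            simp only [u]
            rw [ENNReal.coe_pow, ENNReal.coe_inv two_ne_zero]
            rfl
    rwa [← ENNReal.coe_le_coe, ProbabilityMeasure.ennreal_coeFn_eq_coeFn_toMeasure]
  -- Every limit of `μ` along an ultrafilter has the Laplace functional `L`.
  have hult : ∀ U : Ultrafilter ℕ, (U : Filter ℕ) ≤ atTop →
      ∃ ν : ProbabilityMeasure (PointMeasure E), (∀ k, ν (K k)ᶜ ≤ u k) ∧ Tendsto μ U (𝓝 ν) ∧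
        ∀ g, ∫ N, expNegIntegral g N ∂(ν : Measure (PointMeasure E)) = L g := by
    intro U hU
    obtain ⟨ν, hν, hlim⟩ := hT.ultrafilter_le_nhds' (U.map μ)
      (Ultrafilter.mem_map.2 (Filter.mem_of_superset univ_mem fun n _ => hmem n))
    exact ⟨ν, hν, hlim, fun g => tendsto_nhds_unique
      (ProbabilityMeasure.tendsto_iff_forall_integral_tendsto.1 hlim (expNegIntegral g))
      ((hL g).mono_left hU)⟩
  obtain ⟨ν, hν, -, hνL⟩ := hult (Ultrafilter.of atTop) (Ultrafilter.of_le _)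
  refine ⟨ν, ProbabilityMeasure.tendsto_iff_forall_integral_tendsto.2 fun f => ?_, hνL⟩
  refine tendsto_iff_ultrafilter _ _ _ |>.2 fun U hU => ?_
  obtain ⟨ν', hν', hlim', hνL'⟩ := hult U hU
  have heq : ∫ N, f N ∂(ν : Measure (PointMeasure E)) =
      ∫ N, f N ∂(ν' : Measure (PointMeasure E)) := by
    refine integral_eq_of_laplace_eq (fun ε hε => ?_) (fun g => by rw [hνL, hνL']) f
    obtain ⟨k, hk⟩ := (hu.eventually_lt_const hε).exists
    refine ⟨K k, hK k, ?_, ?_⟩ <;>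
      rw [← ProbabilityMeasure.ennreal_coeFn_eq_coeFn_toMeasure, ENNReal.coe_lt_coe]
    exacts [(hν k).trans_lt hk, (hν' k).trans_lt hk]
  rw [heq]
  exact ProbabilityMeasure.tendsto_iff_forall_integral_tendsto.1 hlim' f

end Laplace

/-! ### Weak convergence in polar coordinates -/

section Polar

variable {V : Type*} [PseudoEMetricSpace V] [MeasurableSpace V] [BorelSpace V]
  [SecondCountableTopology V]

/-- The step function which takes the value `G (1 + i η, s)` for `1 + i η < r ≤ 1 + (i + 1) η`,
for `i < N`, and vanishes for the other `r`. -/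
noncomputable def stepApprox (G : ℝ × V → ℝ) (η : ℝ) (N : ℕ) (p : ℝ × V) : ℝ :=
  ∑ i ∈ Finset.range N,
    ({q : ℝ × V | 1 + i * η < q.1}.indicator (fun q => G (1 + i * η, q.2)) p -
      {q : ℝ × V | 1 + (i + 1 : ℕ) * η < q.1}.indicator (fun q => G (1 + i * η, q.2)) p)

omit [MeasurableSpace V] [BorelSpace V] [SecondCountableTopology V] in
theorem abs_sub_stepApprox_le {G : ℝ × V → ℝ} {L : ℝ≥0} (hL : LipschitzWith L G) {η : ℝ}
    (hη : 0 < η) (N : ℕ) {p : ℝ × V} (hp : 1 < p.1) :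
    |{q : ℝ × V | q.1 ≤ 1 + N * η}.indicator G p - stepApprox G η N p| ≤
      {q : ℝ × V | q.1 ≤ 1 + N * η}.indicator (fun _ => L * η) p := by
  obtain ⟨r, s⟩ := p
  simp only at hp
  induction N with
  | zero => simp [stepApprox, indicator, hp.not_ge]
  | succ N ih =>
    have hstep : 1 + (N : ℝ) * η < 1 + ((N + 1 : ℕ) : ℝ) * η := by push_cast; nlinarith
    rw [stepApprox, Finset.sum_range_succ, ← stepApprox]
    rcases le_or_gt r (1 + N * η) with h1 | h1
    · have h2 : r ≤ 1 + ((N + 1 : ℕ) : ℝ) * η := h1.trans hstep.le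
      simp only [indicator, mem_ofPred_eq, h1, h2, not_lt.2 h1, not_lt.2 h2, if_true, if_false,
        sub_zero, add_zero] at ih ⊢
      exact ih
    · have h0 : stepApprox G η N (r, s) = 0 := by
        simp only [indicator, mem_ofPred_eq, not_le.2 h1, if_false, zero_sub, abs_neg] at ih
        exact abs_nonpos_iff.1 ih
      rcases le_or_gt r (1 + ((N + 1 : ℕ) : ℝ) * η) with h2 | h2
      · simp only [indicator, mem_ofPred_eq, h1, h2, h0, not_lt.2 h2, if_true, if_false,
          sub_zero, zero_add]
        have h3 := hL (r, s) (1 + N * η, s)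
        rw [edist_dist, Prod.edist_eq] at h3
        simp only [edist_self, edist_dist] at h3
        rw [max_eq_left (by simp), ← ENNReal.ofReal_coe_nnreal,
          ← ENNReal.ofReal_mul (NNReal.coe_nonneg L),
          ENNReal.ofReal_le_ofReal_iff (by positivity), Real.dist_eq, Real.dist_eq] at h3
        refine h3.trans ?_
        gcongr
        rw [abs_of_pos (by linarith)]
        push_cast at h2
        linarith
      · simp only [indicator, mem_ofPred_eq, h1, h2, h0, not_le.2 h2, if_true, if_false, sub_self,
          add_zero, abs_zero, le_refl]

/-- Weak convergence of laws on `(1, ∞) × V` follows from the convergence of the integrals of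
`f (s)` over the sets `{r > u}`. A Lipschitz function of `(r, s)` is approximated, uniformly on
`1 < r ≤ T`, by functions which are piecewise constant in `r`. -/
theorem tendsto_of_forall_setIntegral_tendsto {γ : Type*} {F : Filter γ} [F.IsCountablyGenerated]
    {μs : γ → ProbabilityMeasure (ℝ × V)} {μ : ProbabilityMeasure (ℝ × V)}
    (hμs : ∀ i, ∀ᵐ p ∂(μs i : Measure (ℝ × V)), 1 < p.1)
    (hμ : ∀ᵐ p ∂(μ : Measure (ℝ × V)), 1 < p.1)
    (h : ∀ u : ℝ, 1 ≤ u → ∀ f : V →ᵇ ℝ,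
      Tendsto (fun i => ∫ p in {p | u < p.1}, f p.2 ∂(μs i : Measure (ℝ × V))) F
        (𝓝 (∫ p in {p | u < p.1}, f p.2 ∂(μ : Measure (ℝ × V))))) :
    Tendsto μs F (𝓝 μ) := by
  refine tendsto_iff_forall_lipschitz_integral_tendsto.2 fun G ⟨C, hC⟩ ⟨L, hL⟩ => ?_
  have hGc : Continuous G := hL.continuous
  let G' : ℝ × V →ᵇ ℝ := ⟨⟨G, hGc⟩, C, hC⟩
  set M : ℝ := ‖G'‖ with hM
  have hGM : ∀ p, |G p| ≤ M := fun p => G'.norm_coe_le_norm p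
  have hM0 : 0 ≤ M := norm_nonneg _
  have hmeas : ∀ u : ℝ, MeasurableSet {p : ℝ × V | u < p.1} := fun u =>
    measurableSet_lt measurable_const measurable_fst
  rw [Metric.tendsto_nhds]
  intro ε hε
  obtain ⟨η, hη, hLη⟩ : ∃ η : ℝ, 0 < η ∧ L * η ≤ ε / 8 := by
    refine ⟨ε / 8 / (L + 1), by positivity, ?_⟩
    rw [mul_div_assoc', div_le_iff₀ (by positivity)]
    nlinarith [L.2]
  let u : ℕ → ℝ := fun i => 1 + i * η
  have hu : ∀ i, 1 ≤ u i := fun i => by simp only [u]; nlinarith [(Nat.cast_nonneg i : (0 : ℝ) ≤ i)]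
  -- The mass beyond the last grid point is small.
  obtain ⟨N, hN⟩ : ∃ N, M * (μ : Measure (ℝ × V)).real {p | u N < p.1} < ε / 8 := by
    have h1 : Tendsto (fun N => (μ : Measure (ℝ × V)) {p | u N < p.1}) atTop (𝓝 0) := by
      have := tendsto_measure_iInter_atTop (μ := (μ : Measure (ℝ × V)))
        (s := fun N => {p : ℝ × V | u N < p.1}) (fun N => (hmeas _).nullMeasurableSet)
        (fun i j hij p (hp : u j < p.1) => lt_of_le_of_lt (by simp only [u]; gcongr) hp)
        ⟨0, measure_ne_top _ _⟩
      have hempty : ⋂ N, {p : ℝ × V | u N < p.1} = ∅ := by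
        rw [eq_empty_iff_forall_notMem]
        intro p hp
        obtain ⟨k, hk⟩ := exists_nat_gt ((p.1 - 1) / η)
        rw [div_lt_iff₀ hη] at hk
        have : u k < p.1 := mem_iInter.1 hp k
        simp only [u] at this
        linarith
      rwa [hempty, measure_empty] at this
    have h2 := (ENNReal.tendsto_toReal ENNReal.zero_ne_top).comp h1 |>.const_mul M
    simp only [ENNReal.toReal_zero, mul_zero] at h2
    exact (h2.eventually_lt_const (by positivity : (0 : ℝ) < ε / 8)).exists
  have hint : ∀ (ν : ProbabilityMeasure (ℝ × V)) (i j : ℕ), Integrable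
      ({q : ℝ × V | u i < q.1}.indicator (fun q => G (u j, q.2))) (ν : Measure (ℝ × V)) := by
    intro ν i j
    refine Integrable.indicator ?_ (hmeas _)
    exact (G'.compContinuous ⟨fun q : ℝ × V => (u j, q.2), by fun_prop⟩).integrable _
  have hstepint : ∀ ν : ProbabilityMeasure (ℝ × V),
      Integrable (stepApprox G η N) (ν : Measure (ℝ × V)) := fun ν =>
    integrable_finsetSum _ fun i _ => (hint ν i i).sub (hint ν (i + 1) i)
  have hGint : ∀ ν : ProbabilityMeasure (ℝ × V), Integrable G (ν : Measure (ℝ × V)) :=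
    fun ν => G'.integrable _
  have herr : ∀ ν : ProbabilityMeasure (ℝ × V), (∀ᵐ p ∂(ν : Measure (ℝ × V)), 1 < p.1) →
      |∫ p, G p ∂(ν : Measure (ℝ × V)) - ∫ p, stepApprox G η N p ∂(ν : Measure (ℝ × V))| ≤
        ε / 8 + M * (ν : Measure (ℝ × V)).real {p | u N < p.1} := by
    intro ν hν
    rw [← integral_sub (hGint ν) (hstepint ν)]
    calc |∫ p, (G p - stepApprox G η N p) ∂(ν : Measure (ℝ × V))|
        ≤ ∫ p, |G p - stepApprox G η N p| ∂(ν : Measure (ℝ × V)) := abs_integral_le_integral_abs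
      _ ≤ ∫ p, (ε / 8 + {p : ℝ × V | u N < p.1}.indicator (fun _ => M) p)
            ∂(ν : Measure (ℝ × V)) := by
          refine integral_mono_ae ((hGint ν).sub (hstepint ν)).abs
            ((integrable_const _).add ((integrable_const _).indicator (hmeas _))) ?_
          filter_upwards [hν] with p hp
          have hb := abs_sub_stepApprox_le hL hη N hp
          rcases le_or_gt p.1 (u N) with h1 | h1
          · have h1' : p.1 ≤ 1 + (N : ℝ) * η := h1
            simp only [indicator, mem_ofPred_eq, h1', not_lt.2 h1, if_true, if_false,
              add_zero] at hb ⊢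
            exact hb.trans hLη
          · have h1' : ¬ p.1 ≤ 1 + (N : ℝ) * η := not_le.2 h1
            simp only [indicator, mem_ofPred_eq, h1', h1, if_true, if_false, zero_sub,
              abs_neg] at hb ⊢
            rw [abs_nonpos_iff.1 hb, sub_zero]
            linarith [hGM p]
      _ = ε / 8 + M * (ν : Measure (ℝ × V)).real {p | u N < p.1} := by
          rw [integral_add (integrable_const _) ((integrable_const _).indicator (hmeas _)),
            integral_indicator (hmeas _)]
          simp [mul_comm]
  have hstep : Tendsto (fun i => ∫ p, stepApprox G η N p ∂(μs i : Measure (ℝ × V))) F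
      (𝓝 (∫ p, stepApprox G η N p ∂(μ : Measure (ℝ × V)))) := by
    have key : ∀ ν : ProbabilityMeasure (ℝ × V),
        ∫ p, stepApprox G η N p ∂(ν : Measure (ℝ × V)) = ∑ i ∈ Finset.range N,
          (∫ p in {p : ℝ × V | u i < p.1}, G (u i, p.2) ∂(ν : Measure (ℝ × V)) -
            ∫ p in {p : ℝ × V | u (i + 1) < p.1}, G (u i, p.2) ∂(ν : Measure (ℝ × V))) := by
      intro ν
      refine (integral_finsetSum (μ := (ν : Measure (ℝ × V))) (Finset.range N)
        (f := fun i => {q : ℝ × V | u i < q.1}.indicator (fun q => G (u i, q.2)) -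
          {q : ℝ × V | u (i + 1) < q.1}.indicator (fun q => G (u i, q.2)))
        fun i _ => (hint ν i i).sub (hint ν (i + 1) i)).trans ?_
      refine Finset.sum_congr rfl fun i _ => ?_
      have := integral_sub (hint ν i i) (hint ν (i + 1) i)
      rw [integral_indicator (hmeas _), integral_indicator (hmeas _)] at this
      exact this
    simp only [key]
    refine tendsto_finsetSum _ fun i _ => ?_
    let f : V →ᵇ ℝ := G'.compContinuous ⟨fun s : V => (u i, s), by fun_prop⟩
    exact (h (u i) (hu i) f).sub (h (u (i + 1)) (hu (i + 1)) f)
  have htail : Tendsto (fun i => M * (μs i : Measure (ℝ × V)).real {p | u N < p.1}) F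
      (𝓝 (M * (μ : Measure (ℝ × V)).real {p | u N < p.1})) := by
    have := (h (u N) (hu N) (BoundedContinuousFunction.const V 1)).const_mul M
    simpa using this
  filter_upwards [htail.eventually_lt_const hN, Metric.tendsto_nhds.1 hstep (ε / 8) (by positivity)]
    with i hi1 hi2
  have e1 := herr (μs i) (hμs i)
  have e2 := herr μ hμ
  rw [Real.dist_eq] at hi2 ⊢
  rw [abs_le] at e1 e2
  rw [abs_lt] at hi2 ⊢
  constructor <;> linarith

end Polar

/-! ### Regularly varying tails -/

theorem integral_paretoMeasure_one {α : ℝ} (hα : 0 < α) (f : ℝ → ℝ) :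
    ∫ y, f y ∂(paretoMeasure 1 α) = ∫ y in Ioi (1 : ℝ), f y * (α * y ^ (-α - 1)) := by
  have hm : Measurable (paretoPDF 1 α) := (measurable_paretoPDFReal 1 α).ennreal_ofReal
  rw [paretoMeasure, integral_withDensity_eq_integral_toReal_smul₀ hm.aemeasurable
    (ae_of_all _ fun _ => ENNReal.ofReal_lt_top), ← integral_Ici_eq_integral_Ioi,
    ← integral_indicator measurableSet_Ici]
  refine integral_congr_ae (ae_of_all _ fun y => ?_)
  by_cases hy : 1 ≤ y
  · simp only [indicator, mem_Ici, hy, if_true, smul_eq_mul]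
    rw [paretoPDF_of_le hy, ENNReal.toReal_ofReal (by positivity), Real.one_rpow, mul_one, mul_comm,
      neg_add']
  · simp [indicator, hy, paretoPDF_of_lt (not_le.1 hy)]

theorem paretoMeasure_one_real_Ioi {α : ℝ} (hα : 0 < α) {u : ℝ} (hu : 1 ≤ u) :
    (paretoMeasure 1 α).real (Ioi u) = u ^ (-α) := by
  have h := integral_paretoMeasure_one hα ((Ioi u).indicator fun _ => 1)
  rw [integral_indicator measurableSet_Ioi] at h
  simp only [integral_const, smul_eq_mul, mul_one, measureReal_restrict_apply_univ] at h
  rw [h]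
  have h2 : (fun y : ℝ => (Ioi u).indicator (fun _ => (1 : ℝ)) y * (α * y ^ (-α - 1))) =
      (Ioi u).indicator fun y => α * y ^ (-α - 1) := by
    ext y
    by_cases hy : y ∈ Ioi u <;> simp [hy]
  rw [h2, setIntegral_indicator measurableSet_Ioi, inter_eq_right.2 (Ioi_subset_Ioi hu),
    integral_const_mul, integral_Ioi_rpow_of_lt (by linarith) (by linarith)]
  rw [sub_add_cancel]
  field_simp

theorem ae_paretoMeasure_one {α : ℝ} (hα : 0 < α) : ∀ᵐ y ∂(paretoMeasure 1 α), 1 < y := by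
  have := isProbabilityMeasure_paretoMeasure one_pos hα
  have h := paretoMeasure_one_real_Ioi hα le_rfl
  rw [Real.one_rpow, measureReal_def, ENNReal.toReal_eq_one_iff] at h
  exact (prob_compl_eq_zero_iff measurableSet_Ioi).2 h

theorem integral_cond_eq_div {Ω : Type*} [MeasurableSpace Ω] (P : Measure Ω) (s : Set Ω)
    (φ : Ω → ℝ) : ∫ ω, φ ω ∂(P[|s]) = (∫ ω in s, φ ω ∂P) / P.real s := by
  rw [ProbabilityTheory.cond, integral_smul_measure, ENNReal.toReal_inv, smul_eq_mul,
    div_eq_inv_mul]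
  rfl

section Tail

variable {Ω : Type*} [MeasurableSpace Ω] {V : Type*} [PseudoEMetricSpace V] [MeasurableSpace V]

/-- A random element with radial part `R` and angular part `S` has a regularly varying tail with
index `α` and angular law `σ`: for every `u > 0`, the measures `P(R > u x, S ∈ ·) / P(R > x)`
converge weakly to `u ^ (-α) σ` as `x → ∞`. -/
def PolarTail (P : Measure Ω) (α : ℝ) (R : Ω → ℝ) (S : Ω → V) (σ : Measure V) : Prop :=
  ∀ u : ℝ, 0 < u → ∀ f : V →ᵇ ℝ,
    Tendsto (fun x : ℝ => (∫ ω in {ω | u * x < R ω}, f (S ω) ∂P) / P.real {ω | x < R ω}) atTop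
      (𝓝 (u ^ (-α) * ∫ s, f s ∂σ))

namespace PolarTail

variable {P : Measure Ω} [IsProbabilityMeasure P] {α : ℝ} {R : Ω → ℝ} {S : Ω → V} {σ : Measure V}
  [IsProbabilityMeasure σ]

omit [IsProbabilityMeasure P] in
theorem tendsto_ratio (h : PolarTail P α R S σ) {u : ℝ} (hu : 0 < u) :
    Tendsto (fun x : ℝ => P.real {ω | u * x < R ω} / P.real {ω | x < R ω}) atTop
      (𝓝 (u ^ (-α))) := by
  simpa using h u hu (BoundedContinuousFunction.const V 1)

theorem measureReal_pos (h : PolarTail P α R S σ) (x : ℝ) : 0 < P.real {ω | x < R ω} := by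
  have h1 := h.tendsto_ratio one_pos
  rw [Real.one_rpow] at h1
  obtain ⟨y, hy, hxy⟩ := ((h1.eventually_ne one_ne_zero).and (eventually_ge_atTop x)).exists
  have h2 : P.real {ω | y < R ω} ≠ 0 := fun h0 => hy (by rw [h0, div_zero])
  exact (measureReal_nonneg.lt_of_ne' h2).trans_le
    (measureReal_mono fun ω (hω : y < R ω) => hxy.trans_lt hω)

/-- Joint convergence of the radial and the angular part, given a large radius, to a Pareto
variable and an independent angular part. -/
theorem tendsto_integral [BorelSpace V] [SecondCountableTopology V] (h : PolarTail P α R S σ)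
    (hα : 0 < α) (hR : Measurable R) (hS : Measurable S) (G : ℝ × V →ᵇ ℝ) :
    Tendsto (fun x : ℝ => (∫ ω in {ω | x < R ω}, G (x⁻¹ * R ω, S ω) ∂P) / P.real {ω | x < R ω})
      atTop (𝓝 (∫ p, G p ∂((paretoMeasure 1 α).prod σ))) := by
  have := isProbabilityMeasure_paretoMeasure one_pos hα
  have hRm : ∀ x : ℝ, MeasurableSet {ω | x < R ω} := fun x => measurableSet_lt measurable_const hR
  have hpos := h.measureReal_pos
  have hcond : ∀ x, IsProbabilityMeasure (P[|{ω | x < R ω}]) := fun x =>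
    cond_isProbabilityMeasure fun h0 => (hpos x).ne' (by rw [measureReal_def, h0]; rfl)
  have hmap : ∀ x : ℝ, Measurable fun ω => (x⁻¹ * R ω, S ω) := fun x =>
    (hR.const_mul _).prodMk hS
  let μ : ProbabilityMeasure (ℝ × V) := ⟨(paretoMeasure 1 α).prod σ, inferInstance⟩
  -- The law is only of interest for large levels; the maximum keeps the level positive.
  let μs : ℝ → ProbabilityMeasure (ℝ × V) := fun x =>
    ⟨(P[|{ω | max x 1 < R ω}]).map fun ω => ((max x 1)⁻¹ * R ω, S ω),
      Measure.isProbabilityMeasure_map (hmap _).aemeasurable⟩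
  have hlim : Tendsto μs atTop (𝓝 μ) := by
    refine tendsto_of_forall_setIntegral_tendsto (fun x => ?_) ?_ fun u hu f => ?_
    · refine (ae_map_iff (hmap _).aemeasurable
        (measurableSet_lt measurable_const measurable_fst)).2 ?_
      filter_upwards [ae_cond_mem (μ := P) (hRm (max x 1))] with ω hω
      have h1 : 0 < max x 1 := lt_max_of_lt_right one_pos
      rw [lt_inv_mul_iff₀ h1, mul_one]
      exact hω
    · exact Measure.quasiMeasurePreserving_fst.ae (ae_paretoMeasure_one hα)
    · have e1 : ∫ p in {p : ℝ × V | u < p.1}, f p.2 ∂(μ : Measure (ℝ × V)) =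
          u ^ (-α) * ∫ s, f s ∂σ := by
        have h1 := setIntegral_prod_mul (μ := paretoMeasure 1 α) (ν := σ) (fun _ => (1 : ℝ)) f
          (Ioi u) univ
        have h2 : {p : ℝ × V | u < p.1} = Ioi u ×ˢ univ := by ext p; simp
        simp only [one_mul, ← h2, integral_const, smul_eq_mul, mul_one,
          measureReal_restrict_apply_univ, Measure.restrict_univ,
          paretoMeasure_one_real_Ioi hα hu] at h1
        exact h1
      rw [e1]
      refine (h u (zero_lt_one.trans_le hu) f).congr' ?_
      filter_upwards [eventually_ge_atTop 1] with x hx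
      have hx0 : 0 < x := zero_lt_one.trans_le hx
      simp only [μs, ProbabilityMeasure.coe_mk, max_eq_left hx]
      rw [← integral_indicator (measurableSet_lt measurable_const measurable_fst),
        integral_map (hmap x).aemeasurable, integral_cond_eq_div, ← integral_indicator (hRm _),
        ← integral_indicator (hRm _)]
      · congr 2
        ext ω
        have h1 : u < x⁻¹ * R ω ↔ u * x < R ω := by rw [lt_inv_mul_iff₀ hx0, mul_comm]
        have h2 : u * x < R ω → x < R ω := fun h => lt_of_le_of_lt (by nlinarith) h
        by_cases hω : u * x < R ω
        · simp [indicator, h1, hω, h2 hω]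
        · simp [indicator, h1, hω]
      · exact ((f.continuous.measurable.comp measurable_snd).indicator
          (measurableSet_lt measurable_const measurable_fst)).aestronglyMeasurable
  refine ((ProbabilityMeasure.tendsto_iff_forall_integral_tendsto.1 hlim) G).congr' ?_
  filter_upwards [eventually_ge_atTop 1] with x hx
  simp only [μs, ProbabilityMeasure.coe_mk, max_eq_left hx]
  rw [integral_map (hmap x).aemeasurable G.continuous.measurable.aestronglyMeasurable,
    integral_cond_eq_div]

end PolarTail

end Tail

/-! ### Stationarity and the tail of the marginal law -/

theorem exists_tendsto_of_approx {A : ℝ → ℝ}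
    (h : ∀ ε : ℝ, 0 < ε → ∃ (B : ℝ → ℝ) (l : ℝ), Tendsto B atTop (𝓝 l) ∧
      ∀ᶠ x in atTop, |A x - B x| ≤ ε) : ∃ l, Tendsto A atTop (𝓝 l) := by
  refine cauchySeq_tendsto_of_complete (Metric.cauchySeq_iff'.2 fun ε hε => ?_)
  obtain ⟨B, l, hB, hAB⟩ := h (ε / 8) (by positivity)
  obtain ⟨x₀, hx₀⟩ := eventually_atTop.1
    (hAB.and (Metric.tendsto_nhds.1 hB (ε / 8) (by positivity)))
  refine ⟨x₀, fun x hx => ?_⟩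
  have h1 := hx₀ x hx
  have h2 := hx₀ x₀ le_rfl
  simp only [Real.dist_eq] at h1 h2 ⊢
  rw [abs_le, abs_lt] at h1 h2
  rw [abs_lt]
  constructor <;> linarith [h1.1.1, h1.1.2, h1.2.1, h1.2.2, h2.1.1, h2.1.2, h2.2.1, h2.2.2]

section Shift

variable {Ω : Type*} [MeasurableSpace Ω] {P : Measure Ω} {V : Type*} [MeasurableSpace V]
  {X : ℤ → Ω → V}

theorem StrictlyStationary.integral_shift (h : StrictlyStationary P X) (hX : ∀ t, Measurable (X t))
    (k : ℤ) {F : (ℤ → V) → ℝ} (hF : Measurable F) :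
    ∫ ω, F (fun t => X (t + k) ω) ∂P = ∫ ω, F (fun t => X t ω) ∂P := by
  rw [← integral_map (φ := fun ω t => X (t + k) ω)
    (measurable_pi_lambda _ fun t => hX _).aemeasurable hF.aestronglyMeasurable, h k,
    integral_map (measurable_pi_lambda _ fun t => hX _).aemeasurable hF.aestronglyMeasurable]

theorem StrictlyStationary.measureReal_shift (h : StrictlyStationary P X)
    (hX : ∀ t, Measurable (X t)) (k : ℤ) {B : Set (ℤ → V)} (hB : MeasurableSet B) :
    P.real {ω | (fun t => X (t + k) ω) ∈ B} = P.real {ω | (fun t => X t ω) ∈ B} := by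
  have h1 := Measure.map_apply (μ := P) (f := fun ω t => X (t + k) ω)
    (measurable_pi_lambda _ fun t => hX _) hB
  have h2 := Measure.map_apply (μ := P) (f := fun ω t => X t ω)
    (measurable_pi_lambda _ fun t => hX _) hB
  rw [h k, h2] at h1
  rw [measureReal_def, measureReal_def]
  exact congrArg ENNReal.toReal h1.symm

end Shift

section Tail

variable {Ω : Type*} [MeasurableSpace Ω] {P : Measure Ω} {d : ℕ}
  {X : ℤ → Ω → EuclideanSpace ℝ (Fin d)}

theorem StrictlyStationary.tail_eq (h : StrictlyStationary P X) (hX : ∀ t, Measurable (X t))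
    (t : ℤ) (x : ℝ) : P.real {ω | x < ‖X t ω‖} = P.real {ω | x < ‖X 0 ω‖} := by
  have := h.measureReal_shift hX t (B := {y | x < ‖y 0‖})
    (measurableSet_lt measurable_const (measurable_pi_apply 0).norm)
  simpa using this

/-- The random vector `(X_1, …, X_n)` with its Euclidean norm. -/
noncomputable def blockVector (X : ℤ → Ω → EuclideanSpace ℝ (Fin d)) (n : ℕ) (ω : Ω) :
    PiLp 2 fun _ : Fin n => EuclideanSpace ℝ (Fin d) :=
  WithLp.toLp 2 fun i : Fin n => X ((i : ℤ) + 1) ω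

theorem measurable_blockVector (hX : ∀ t, Measurable (X t)) (n : ℕ) :
    Measurable (blockVector X n) :=
  (WithLp.measurable_toLp 2 _).comp (measurable_pi_lambda _ fun _ => hX _)

theorem RegularlyVaryingSeq.exists_polarTail {α : ℝ} (h : RegularlyVaryingSeq P α X) {n : ℕ}
    (hn : 1 ≤ n) : ∃ σ : Measure (PiLp 2 fun _ : Fin n => EuclideanSpace ℝ (Fin d)),
      IsProbabilityMeasure σ ∧ PolarTail P α (fun ω => ‖blockVector X n ω‖)
        (fun ω => ‖blockVector X n ω‖⁻¹ • blockVector X n ω) σ := by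
  obtain ⟨σ, hσ, -, h⟩ := h n hn
  exact ⟨σ, hσ, h⟩

/-- The tail of `|X_0|` is regularly varying with index `-α`. -/
theorem RegularlyVaryingSeq.exists_polarTail_norm {α : ℝ} (h : RegularlyVaryingSeq P α X)
    (hst : StrictlyStationary P X) (hX : ∀ t, Measurable (X t)) :
    PolarTail P α (fun ω => ‖X 0 ω‖) (fun _ => ()) (Measure.dirac ()) := by
  obtain ⟨σ, hσ, h⟩ := h.exists_polarTail le_rfl
  intro u hu f
  have h1 := h u hu (BoundedContinuousFunction.const _ (f ()))
  have hn : ∀ ω, ‖blockVector X 1 ω‖ = ‖X 1 ω‖ := fun ω => by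
    simp [blockVector, PiLp.norm_eq_of_L2]
  simpa [hn, hst.tail_eq hX] using h1

omit [MeasurableSpace Ω] in
theorem norm_blockVector_ge (n : ℕ) (i : Fin n) (ω : Ω) :
    ‖X ((i : ℤ) + 1) ω‖ ≤ ‖blockVector X n ω‖ :=
  PiLp.norm_apply_le (blockVector X n ω) i

theorem tail_blockVector_le [IsProbabilityMeasure P] (hst : StrictlyStationary P X)
    (hX : ∀ t, Measurable (X t)) (n : ℕ) {x : ℝ} (hx : 0 < x) :
    P.real {ω | x < ‖blockVector X n ω‖} ≤ n * P.real {ω | (n : ℝ)⁻¹ * x < ‖X 0 ω‖} := by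
  have hsub : {ω | x < ‖blockVector X n ω‖} ⊆
      ⋃ i : Fin n, {ω | (n : ℝ)⁻¹ * x < ‖X ((i : ℤ) + 1) ω‖} := by
    intro ω hω
    by_contra hcon
    simp only [mem_iUnion, mem_ofPred_eq, not_exists, not_lt] at hcon hω
    have h2 : ‖blockVector X n ω‖ ^ 2 ≤ x ^ 2 := by
      rw [PiLp.norm_sq_eq_of_L2]
      rcases Nat.eq_zero_or_pos n with rfl | hn
      · simp; positivity
      have hn' : (1 : ℝ) ≤ n := by exact_mod_cast hn
      calc ∑ i, ‖blockVector X n ω i‖ ^ 2 ≤ ∑ _i : Fin n, ((n : ℝ)⁻¹ * x) ^ 2 := by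
            gcongr with i
            exact hcon i
        _ = (n : ℝ)⁻¹ * x ^ 2 := by
            rw [Finset.sum_const, Finset.card_univ, Fintype.card_fin, nsmul_eq_mul]
            field_simp
        _ ≤ x ^ 2 := mul_le_of_le_one_left (by positivity) (inv_le_one_of_one_le₀ hn')
    exact absurd ((sq_le_sq₀ (norm_nonneg _) hx.le).1 h2) (not_le.2 hω)
  calc P.real {ω | x < ‖blockVector X n ω‖}
      ≤ P.real (⋃ i : Fin n, {ω | (n : ℝ)⁻¹ * x < ‖X ((i : ℤ) + 1) ω‖}) := measureReal_mono hsub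
    _ ≤ ∑ i : Fin n, P.real {ω | (n : ℝ)⁻¹ * x < ‖X ((i : ℤ) + 1) ω‖} :=
        measureReal_iUnion_fintype_le _
    _ = n * P.real {ω | (n : ℝ)⁻¹ * x < ‖X 0 ω‖} := by
        simp [hst.tail_eq hX]

/-! ### The spectral tail process -/

/-- The continuous function which is `0` on `(-∞, 1]`, `1` on `[1 + ε, ∞)` and affine between. -/
noncomputable def ramp (ε y : ℝ) : ℝ := max 0 (min 1 ((y - 1) / ε))

theorem continuous_ramp (ε : ℝ) : Continuous (ramp ε) := by
  unfold ramp
  fun_prop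

theorem ramp_nonneg (ε y : ℝ) : 0 ≤ ramp ε y := le_max_left _ _

theorem ramp_le_one (ε y : ℝ) : ramp ε y ≤ 1 := max_le zero_le_one (min_le_left _ _)

theorem ramp_eq_zero {ε y : ℝ} (hε : 0 < ε) (hy : y ≤ 1) : ramp ε y = 0 :=
  max_eq_left ((min_le_right _ _).trans (div_nonpos_of_nonpos_of_nonneg (by linarith) hε.le))

theorem ramp_eq_one {ε y : ℝ} (hε : 0 < ε) (hy : 1 + ε ≤ y) : ramp ε y = 1 := by
  rw [ramp, min_eq_left ((one_le_div hε).2 (by linarith)), max_eq_right zero_le_one]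

/-- The position of time `t ∈ [-k, k]` in the block `1, …, 2k + 1`, counted from `0`. -/
def blockIndex (k : ℕ) (t : Finset.Icc (-(k : ℤ)) k) : Fin (2 * k + 1) :=
  ⟨((t : ℤ) + k).toNat, by have := Finset.mem_Icc.1 t.2; omega⟩

theorem blockIndex_cast (k : ℕ) (t : Finset.Icc (-(k : ℤ)) k) :
    ((blockIndex k t : ℕ) : ℤ) + 1 = t + (k + 1) := by
  have := Finset.mem_Icc.1 t.2
  simp only [blockIndex]
  omega

/-- The test function `z ↦ ramp ε |z_0| f (z / |z_0|)`, which vanishes for `|z_0| ≤ 1`. The norm is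
replaced by `max |z_0| 1` in the second factor, which makes continuity evident and changes
nothing. -/
noncomputable def rampTest (k : ℕ) (ε : ℝ)
    (f : (Finset.Icc (-(k : ℤ)) k → EuclideanSpace ℝ (Fin d)) →ᵇ ℝ) :
    (PiLp 2 fun _ : Fin (2 * k + 1) => EuclideanSpace ℝ (Fin d)) →ᵇ ℝ :=
  BoundedContinuousFunction.ofNormedAddCommGroup
    (fun z => ramp ε ‖z ⟨k, by omega⟩‖ *
      f (fun t => (max ‖z ⟨k, by omega⟩‖ 1)⁻¹ • z (blockIndex k t)))
    (by
      have hc : ∀ i, Continuous fun z : PiLp 2 fun _ : Fin (2 * k + 1) =>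
          EuclideanSpace ℝ (Fin d) => z i := fun i => PiLp.continuous_apply 2 _ i
      refine ((continuous_ramp ε).comp (hc _).norm).mul (f.continuous.comp ?_)
      refine continuous_pi fun t =>
        (((hc _).norm.max continuous_const).inv₀ fun z => ?_).smul (hc _)
      exact (lt_max_of_lt_right one_pos).ne')
    ‖f‖ fun z => by
      rw [norm_mul, Real.norm_eq_abs, abs_of_nonneg (ramp_nonneg _ _)]
      exact (mul_le_of_le_one_left (norm_nonneg _) (ramp_le_one _ _)).trans (f.norm_coe_le_norm _)

theorem rampTest_apply (k : ℕ) (ε : ℝ)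
    (f : (Finset.Icc (-(k : ℤ)) k → EuclideanSpace ℝ (Fin d)) →ᵇ ℝ)
    (z : PiLp 2 fun _ : Fin (2 * k + 1) => EuclideanSpace ℝ (Fin d)) :
    rampTest k ε f z = ramp ε ‖z ⟨k, by omega⟩‖ *
      f (fun t => (max ‖z ⟨k, by omega⟩‖ 1)⁻¹ • z (blockIndex k t)) := rfl

omit [MeasurableSpace Ω] in
theorem abs_indicator_sub_rampTest_le (k : ℕ) {η x : ℝ} (hη : 0 < η) (hx : 0 < x)
    (f : (Finset.Icc (-(k : ℤ)) k → EuclideanSpace ℝ (Fin d)) →ᵇ ℝ) (ω : Ω) :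
    |{ω | x < ‖X (k + 1) ω‖}.indicator
        (fun ω => f (fun t => ‖X (k + 1) ω‖⁻¹ • X (t + (k + 1)) ω)) ω -
      rampTest k η f (x⁻¹ • blockVector X (2 * k + 1) ω)| ≤
    {ω | x < ‖X (k + 1) ω‖}.indicator (fun _ => ‖f‖) ω -
      {ω | (1 + η) * x < ‖X (k + 1) ω‖}.indicator (fun _ => ‖f‖) ω := by
  have hZc : blockVector X (2 * k + 1) ω ⟨k, by omega⟩ = X (k + 1) ω := rfl
  have hZi : ∀ t, blockVector X (2 * k + 1) ω (blockIndex k t) = X (t + (k + 1)) ω := fun t => by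
    rw [← blockIndex_cast]; rfl
  simp only [rampTest_apply, PiLp.smul_apply, hZc, hZi, norm_smul, norm_inv,
    Real.norm_eq_abs, abs_of_pos hx]
  rcases le_or_gt ‖X (k + 1) ω‖ x with h1 | h1
  · have h2 : ¬ (1 + η) * x < ‖X (k + 1) ω‖ := not_lt.2 (h1.trans (by nlinarith))
    have h3 : x⁻¹ * ‖X (k + 1) ω‖ ≤ 1 := by rwa [inv_mul_le_iff₀ hx, mul_one]
    simp [indicator, not_lt.2 h1, h2, ramp_eq_zero hη h3]
  · have h3 : 1 ≤ x⁻¹ * ‖X (k + 1) ω‖ := by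
      rw [le_inv_mul_iff₀ hx, mul_one]; exact h1.le
    have h4 : (fun t : Finset.Icc (-(k : ℤ)) k =>
        (max (x⁻¹ * ‖X (k + 1) ω‖) 1)⁻¹ • x⁻¹ • X (t + (k + 1)) ω) =
        fun t : Finset.Icc (-(k : ℤ)) k => ‖X (k + 1) ω‖⁻¹ • X (t + (k + 1)) ω := by
      ext1 t
      rw [max_eq_left h3, smul_smul, mul_inv, inv_inv, mul_right_comm,
        mul_inv_cancel₀ hx.ne', one_mul]
    rw [h4]
    rcases le_or_gt ‖X (k + 1) ω‖ ((1 + η) * x) with h2 | h2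
    · simp only [indicator, mem_ofPred_eq, h1, not_lt.2 h2, if_true, if_false, sub_zero]
      rw [← one_sub_mul, abs_mul, abs_of_nonneg (sub_nonneg.2 (ramp_le_one _ _))]
      exact (mul_le_of_le_one_left (abs_nonneg _)
        (by linarith [ramp_nonneg η (x⁻¹ * ‖X (k + 1) ω‖)])).trans (f.norm_coe_le_norm _)
    · have h5 : 1 + η ≤ x⁻¹ * ‖X (k + 1) ω‖ := by
        rw [le_inv_mul_iff₀ hx, mul_comm]; exact h2.le
      simp [indicator, h1, h2, ramp_eq_one hη h5]

theorem StrictlyStationary.setIntegral_window (hst : StrictlyStationary P X)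
    (hX : ∀ t, Measurable (X t)) (k : ℕ) (s : ℤ) (x : ℝ)
    (f : (Finset.Icc (-(k : ℤ)) k → EuclideanSpace ℝ (Fin d)) →ᵇ ℝ) :
    ∫ ω, {ω | x < ‖X s ω‖}.indicator (fun ω => f (fun t => ‖X s ω‖⁻¹ • X (t + s) ω)) ω ∂P =
      ∫ ω in {ω | x < ‖X 0 ω‖}, f (fun t => ‖X 0 ω‖⁻¹ • X t ω) ∂P := by
  rw [← integral_indicator (measurableSet_lt measurable_const (hX 0).norm)]
  let F : (ℤ → EuclideanSpace ℝ (Fin d)) → ℝ := {y | x < ‖y 0‖}.indicator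
    fun y => f (fun t => ‖y 0‖⁻¹ • y t)
  have hF : Measurable F := by
    refine Measurable.indicator ?_ (measurableSet_lt measurable_const (measurable_pi_apply 0).norm)
    refine f.continuous.measurable.comp (measurable_pi_lambda _ fun t => ?_)
    exact (measurable_pi_apply 0).norm.inv.smul (measurable_pi_apply _)
  have := hst.integral_shift hX s hF
  simpa [F, indicator] using this

variable [IsProbabilityMeasure P]

/-- Test functions of the rescaled block which vanish on the unit ball have converging means, after
division by the tail of the norm of the block. -/
theorem PolarTail.exists_tendsto_of_eq_zero {α : ℝ} {V : Type*} [NormedAddCommGroup V]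
    [NormedSpace ℝ V] [MeasurableSpace V] [BorelSpace V] [SecondCountableTopology V] {Z : Ω → V}
    {σ : Measure V} [IsProbabilityMeasure σ] (hα : 0 < α)
    (h : PolarTail P α (fun ω => ‖Z ω‖) (fun ω => ‖Z ω‖⁻¹ • Z ω) σ)
    (hZ : Measurable Z) (H : V →ᵇ ℝ) (hH : ∀ z, ‖z‖ ≤ 1 → H z = 0) :
    ∃ l, Tendsto (fun x : ℝ => (∫ ω, H (x⁻¹ • Z ω) ∂P) / P.real {ω | x < ‖Z ω‖}) atTop (𝓝 l) := by
  let G : ℝ × V →ᵇ ℝ := H.compContinuous ⟨fun p : ℝ × V => p.1 • p.2, by fun_prop⟩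
  refine ⟨_, (h.tendsto_integral hα hZ.norm (hZ.norm.inv.smul hZ) G).congr' ?_⟩
  filter_upwards [eventually_gt_atTop 0] with x hx
  congr 1
  rw [← integral_indicator (measurableSet_lt measurable_const hZ.norm)]
  refine integral_congr_ae (ae_of_all _ fun ω => ?_)
  by_cases hω : x < ‖Z ω‖
  · have hne : ‖Z ω‖ ≠ 0 := (hx.trans hω).ne'
    simp only [indicator, mem_ofPred_eq, hω, if_true]
    change H ((x⁻¹ * ‖Z ω‖) • (‖Z ω‖⁻¹ • Z ω)) = _
    rw [smul_smul, mul_assoc, mul_inv_cancel₀ hne, mul_one]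
  · simp only [indicator, mem_ofPred_eq, hω, if_false]
    refine (hH _ ?_).symm
    rw [norm_smul, norm_inv, Real.norm_eq_abs, abs_of_pos hx, inv_mul_le_iff₀ hx, mul_one]
    exact not_lt.1 hω

theorem abs_setIntegral_sub_integral_rampTest_le (hst : StrictlyStationary P X)
    (hX : ∀ t, Measurable (X t)) (k : ℕ) {η x : ℝ} (hη : 0 < η) (hx : 0 < x)
    (f : (Finset.Icc (-(k : ℤ)) k → EuclideanSpace ℝ (Fin d)) →ᵇ ℝ) :
    |∫ ω in {ω | x < ‖X 0 ω‖}, f (fun t => ‖X 0 ω‖⁻¹ • X t ω) ∂P -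
      ∫ ω, rampTest k η f (x⁻¹ • blockVector X (2 * k + 1) ω) ∂P| ≤
        ‖f‖ * (P.real {ω | x < ‖X 0 ω‖} - P.real {ω | (1 + η) * x < ‖X 0 ω‖}) := by
  have hXm : ∀ c : ℝ, MeasurableSet {ω | c < ‖X (k + 1) ω‖} := fun c =>
    measurableSet_lt measurable_const (hX _).norm
  have hfmeas : Measurable fun ω => f (fun t => ‖X (k + 1) ω‖⁻¹ • X (t + (k + 1)) ω) :=
    f.continuous.measurable.comp (measurable_pi_lambda _ fun t => (hX _).norm.inv.smul (hX _))
  have hint1 : Integrable ({ω | x < ‖X (k + 1) ω‖}.indicator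
      (fun ω => f (fun t => ‖X (k + 1) ω‖⁻¹ • X (t + (k + 1)) ω))) P :=
    (Integrable.of_bound hfmeas.aestronglyMeasurable ‖f‖
      (ae_of_all _ fun ω => f.norm_coe_le_norm _)).indicator (hXm x)
  have hint2 : Integrable (fun ω => rampTest k η f (x⁻¹ • blockVector X (2 * k + 1) ω)) P :=
    Integrable.of_bound ((rampTest k η f).continuous.measurable.comp
      ((measurable_blockVector hX (2 * k + 1)).const_smul x⁻¹)).aestronglyMeasurable
      ‖rampTest k η f‖ (ae_of_all _ fun ω => (rampTest k η f).norm_coe_le_norm _)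
  -- The centre of the window is shifted to the centre of the block.
  rw [← hst.setIntegral_window hX k (k + 1), ← integral_sub hint1 hint2]
  calc _ ≤ ∫ ω, |{ω | x < ‖X (k + 1) ω‖}.indicator
          (fun ω => f (fun t => ‖X (k + 1) ω‖⁻¹ • X (t + (k + 1)) ω)) ω -
            rampTest k η f (x⁻¹ • blockVector X (2 * k + 1) ω)| ∂P := abs_integral_le_integral_abs
    _ ≤ ∫ ω, ({ω | x < ‖X (k + 1) ω‖}.indicator (fun _ => ‖f‖) ω -
          {ω | (1 + η) * x < ‖X (k + 1) ω‖}.indicator (fun _ => ‖f‖) ω) ∂P := by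
        refine integral_mono (hint1.sub hint2).abs (((integrable_const _).indicator (hXm _)).sub
          ((integrable_const _).indicator (hXm _))) fun ω => ?_
        exact abs_indicator_sub_rampTest_le k hη hx f ω
    _ = _ := by
        rw [integral_sub ((integrable_const _).indicator (hXm _))
          ((integrable_const _).indicator (hXm _)), integral_indicator (hXm _),
          integral_indicator (hXm _)]
        simp [hst.tail_eq hX]
        ring

/-- The conditional means which define the spectral tail process converge, first after division
by the tail of the norm of a whole block. The indicator of `|X_0| > x` is replaced by a ramp. -/
theorem exists_tendsto_div_tail_blockVector {α : ℝ} (hα : 0 < α)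
    (hX : ∀ t, Measurable (X t)) (hst : StrictlyStationary P X) (hRV : RegularlyVaryingSeq P α X)
    (k : ℕ) (f : (Finset.Icc (-(k : ℤ)) k → EuclideanSpace ℝ (Fin d)) →ᵇ ℝ) :
    ∃ l, Tendsto (fun x : ℝ =>
      (∫ ω in {ω | x < ‖X 0 ω‖}, f (fun t => ‖X 0 ω‖⁻¹ • X t ω) ∂P) /
        P.real {ω | x < ‖blockVector X (2 * k + 1) ω‖}) atTop (𝓝 l) := by
  set Z := blockVector X (2 * k + 1) with hZdef
  have hZ : Measurable Z := measurable_blockVector hX _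
  obtain ⟨σ, hσ, hpol⟩ := hRV.exists_polarTail (n := 2 * k + 1) (by omega)
  have htail := hRV.exists_polarTail_norm hst hX
  refine exists_tendsto_of_approx fun ε hε => ?_
  -- The ramp is chosen so steep that the mass of its slope is at most `ε`.
  obtain ⟨η, hη, hη'⟩ : ∃ η : ℝ, 0 < η ∧ ‖f‖ * (1 - (1 + η) ^ (-α)) < ε := by
    have hc : ContinuousAt (fun η : ℝ => ‖f‖ * (1 - (1 + η) ^ (-α))) 0 := by
      refine ContinuousAt.mul continuousAt_const (continuousAt_const.sub ?_)
      exact ContinuousAt.rpow_const (by fun_prop) (Or.inl (by simp))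
    have h0 : ‖f‖ * (1 - (1 + (0 : ℝ)) ^ (-α)) < ε := by simpa using hε
    obtain ⟨δ, hδ, hδ'⟩ := Metric.eventually_nhds_iff.1 (hc.eventually_lt_const h0)
    exact ⟨δ / 2, by positivity, hδ' (by
      rw [Real.dist_eq, sub_zero, abs_of_pos (by positivity)]; linarith)⟩
  obtain ⟨l, hl⟩ := hpol.exists_tendsto_of_eq_zero hα hZ (rampTest k η f) fun z hz => by
    rw [rampTest_apply, ramp_eq_zero hη ((PiLp.norm_apply_le z _).trans hz), zero_mul]
  refine ⟨_, l, hl, ?_⟩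
  have hlim := ((tendsto_const_nhds (x := (1 : ℝ))).sub
    (htail.tendsto_ratio (by positivity : (0 : ℝ) < 1 + η))).const_mul ‖f‖
  filter_upwards [eventually_gt_atTop 0, hlim.eventually_lt_const hη'] with x hx hxε
  have hT : 0 < P.real {ω | x < ‖X 0 ω‖} := htail.measureReal_pos x
  have hTq : P.real {ω | x < ‖X 0 ω‖} ≤ P.real {ω | x < ‖Z ω‖} := by
    rw [← hst.tail_eq hX (k + 1) x]
    refine measureReal_mono fun ω (hω : x < ‖X (k + 1) ω‖) => ?_
    exact hω.trans_le (norm_blockVector_ge (X := X) (2 * k + 1) ⟨k, by omega⟩ ω)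
  rw [← sub_div, abs_div, abs_of_pos (hT.trans_le hTq), div_le_iff₀ (hT.trans_le hTq)]
  refine (abs_setIntegral_sub_integral_rampTest_le hst hX k hη hx f).trans ?_
  have e1 : ‖f‖ * (P.real {ω | x < ‖X 0 ω‖} - P.real {ω | (1 + η) * x < ‖X 0 ω‖}) =
      ‖f‖ * (1 - P.real {ω | (1 + η) * x < ‖X 0 ω‖} / P.real {ω | x < ‖X 0 ω‖}) *
        P.real {ω | x < ‖X 0 ω‖} := by
    field_simp
  rw [e1]
  exact mul_le_mul hxε.le hTq hT.le hε.le

/-- The conditional means which define the spectral tail process converge. -/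
theorem exists_tendsto_spectral {α : ℝ} (hα : 0 < α)
    (hX : ∀ t, Measurable (X t)) (hst : StrictlyStationary P X) (hRV : RegularlyVaryingSeq P α X)
    (k : ℕ) (f : (Finset.Icc (-(k : ℤ)) k → EuclideanSpace ℝ (Fin d)) →ᵇ ℝ) :
    ∃ l, Tendsto (fun x : ℝ =>
      (∫ ω in {ω | x < ‖X 0 ω‖}, f (fun t => ‖X 0 ω‖⁻¹ • X t ω) ∂P) /
        P.real {ω | x < ‖X 0 ω‖}) atTop (𝓝 l) := by
  obtain ⟨l, hl⟩ := exists_tendsto_div_tail_blockVector hα hX hst hRV k f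
  obtain ⟨c, hc⟩ := exists_tendsto_div_tail_blockVector hα hX hst hRV k
    (BoundedContinuousFunction.const _ 1)
  have htail := hRV.exists_polarTail_norm hst hX
  obtain ⟨σ, hσ, hpol⟩ := hRV.exists_polarTail (n := 2 * k + 1) (by omega)
  simp only [BoundedContinuousFunction.const_apply, integral_const, smul_eq_mul, mul_one,
    measureReal_restrict_apply_univ] at hc
  set n := 2 * k + 1 with hn
  have hn0 : (0 : ℝ) < n := by rw [hn]; positivity
  -- The tail of the norm of the block is of the same order as the tail of `|X_0|`.
  have hcpos : 0 < c := by
    have h1 := (htail.tendsto_ratio (inv_pos.2 hn0)).inv₀ (by positivity)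
    refine lt_of_lt_of_le ?_ (le_of_tendsto_of_tendsto (h1.const_mul (n : ℝ)⁻¹) hc ?_)
    · positivity
    · filter_upwards [eventually_gt_atTop 0] with x hx
      have hT := htail.measureReal_pos ((n : ℝ)⁻¹ * x)
      rw [inv_div, ← div_eq_inv_mul, div_div]
      have hb := tail_blockVector_le (P := P) hst hX n hx
      have hq := hpol.measureReal_pos x
      rw [mul_comm] at hb
      gcongr
  refine ⟨l / c, (hl.div hc hcpos.ne').congr fun x => ?_⟩
  exact div_div_div_cancel_right₀ (hpol.measureReal_pos x).ne' _ _

end Tail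

section Existence

variable {Ω : Type*} [MeasurableSpace Ω] {P : Measure Ω} [IsProbabilityMeasure P]

theorem exists_measureReal_lt {R : Ω → ℝ} (hR : Measurable R) {ε : ℝ} (hε : 0 < ε) :
    ∃ M : ℝ, 1 ≤ M ∧ P.real {ω | M < R ω} < ε := by
  have h1 := tendsto_measure_iInter_atTop (μ := P) (s := fun N : ℕ => {ω | (N : ℝ) < R ω})
    (fun N => (measurableSet_lt measurable_const hR).nullMeasurableSet)
    (fun i j hij ω (hω : (j : ℝ) < R ω) => lt_of_le_of_lt (by exact_mod_cast hij) hω)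
    ⟨0, measure_ne_top _ _⟩
  have hempty : ⋂ N : ℕ, {ω | (N : ℝ) < R ω} = ∅ := by
    rw [eq_empty_iff_forall_notMem]
    intro ω hω
    obtain ⟨N, hN⟩ := exists_nat_gt (R ω)
    exact lt_asymm hN (mem_iInter.1 hω N)
  rw [hempty, measure_empty] at h1
  have h2 := (ENNReal.tendsto_toReal ENNReal.zero_ne_top).comp h1
  obtain ⟨N, hN, hN1⟩ := ((h2.eventually_lt_const hε).and (eventually_ge_atTop 1)).exists
  exact ⟨N, by exact_mod_cast hN1, hN⟩

theorem measureReal_tail_anti (R : Ω → ℝ) {x y : ℝ} (hxy : x ≤ y) :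
    P.real {ω | y < R ω} ≤ P.real {ω | x < R ω} :=
  measureReal_mono fun _ hω => lt_of_le_of_lt hxy hω

/-- Tightness of `R / (n + 1)` given `R > n + 1`, uniformly in `n`: regular variation takes care of
large `n`, and finitely many `n` remain. -/
theorem PolarTail.exists_ratio_le {α : ℝ} (hα : 0 < α) {V : Type*} [PseudoEMetricSpace V]
    [MeasurableSpace V] {R : Ω → ℝ} {S : Ω → V} {σ : Measure V} [IsProbabilityMeasure σ]
    (h : PolarTail P α R S σ) (hR : Measurable R) {ε : ℝ} (hε : 0 < ε) :
    ∃ M : ℝ, 0 < M ∧ ∀ n : ℕ,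
      P.real {ω | M * ((n : ℝ) + 1) < R ω} / P.real {ω | (n : ℝ) + 1 < R ω} ≤ ε := by
  obtain ⟨M₁, hM₁, hM₁0⟩ := (((tendsto_rpow_neg_atTop hα).eventually_lt_const hε).and
    (eventually_gt_atTop 0)).exists
  have h1 := ((h.tendsto_ratio hM₁0).comp
    (tendsto_atTop_add_const_right _ (1 : ℝ) tendsto_natCast_atTop_atTop)).eventually_lt_const hM₁
  obtain ⟨n₀, hn₀⟩ := eventually_atTop.1 h1
  have hpos := h.measureReal_pos
  obtain ⟨M₂, hM₂, hM₂ε⟩ := exists_measureReal_lt (P := P) hR (mul_pos hε (hpos ((n₀ : ℝ) + 1)))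
  refine ⟨max M₁ M₂, lt_max_of_lt_left hM₁0, fun n => ?_⟩
  rw [div_le_iff₀ (hpos _)]
  have hn1 : (0 : ℝ) < (n : ℝ) + 1 := by positivity
  rcases le_or_gt n₀ n with hn | hn
  · have h2 := (hn₀ n hn).le
    simp only [Function.comp] at h2
    rw [div_le_iff₀ (hpos _)] at h2
    refine (measureReal_tail_anti R ?_).trans h2
    exact mul_le_mul_of_nonneg_right (le_max_left _ _) hn1.le
  · calc P.real {ω | max M₁ M₂ * ((n : ℝ) + 1) < R ω} ≤ P.real {ω | M₂ < R ω} := by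
          refine measureReal_tail_anti R ?_
          have : M₂ ≤ max M₁ M₂ := le_max_right _ _
          nlinarith [(Nat.cast_nonneg n : (0 : ℝ) ≤ n)]
      _ ≤ ε * P.real {ω | (n₀ : ℝ) + 1 < R ω} := hM₂ε.le
      _ ≤ ε * P.real {ω | (n : ℝ) + 1 < R ω} := by
          refine mul_le_mul_of_nonneg_left (measureReal_tail_anti R ?_) hε.le
          gcongr

variable {d : ℕ} {X : ℤ → Ω → EuclideanSpace ℝ (Fin d)}

/-- **Existence of the spectral tail process.** The laws of `(X_t / |X_0|)` given `|X_0| > n + 1`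
are tight on the path space, so by Prokhorov's theorem they have a limit along an ultrafilter. The
conditional means of functions of finitely many coordinates converge, hence the limit does not
depend on the ultrafilter and is attained along all real levels. -/
theorem exists_isSpectralTailLaw {α : ℝ} (hα : 0 < α) (hX : ∀ t, Measurable (X t))
    (hst : StrictlyStationary P X) (hRV : RegularlyVaryingSeq P α X) :
    ∃ Q : Measure (ℤ → EuclideanSpace ℝ (Fin d)), IsSpectralTailLaw P X Q := by
  have htail := hRV.exists_polarTail_norm hst hX
  have hpos := htail.measureReal_pos
  have hRm : ∀ x : ℝ, MeasurableSet {ω | x < ‖X 0 ω‖} := fun x =>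
    measurableSet_lt measurable_const (hX 0).norm
  have hcond : ∀ x : ℝ, IsProbabilityMeasure (P[|{ω | x < ‖X 0 ω‖}]) := fun x =>
    cond_isProbabilityMeasure fun h0 => (hpos x).ne' (by rw [measureReal_def, h0]; rfl)
  have hm : Measurable fun ω (t : ℤ) => ‖X 0 ω‖⁻¹ • X t ω :=
    measurable_pi_lambda _ fun t => (hX 0).norm.inv.smul (hX t)
  let ρ : ℕ → ProbabilityMeasure (ℤ → EuclideanSpace ℝ (Fin d)) := fun n =>
    ⟨(P[|{ω | (n : ℝ) + 1 < ‖X 0 ω‖}]).map fun ω t => ‖X 0 ω‖⁻¹ • X t ω,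
      Measure.isProbabilityMeasure_map hm.aemeasurable⟩
  have htight : IsTightMeasureSet
      {((μ : ProbabilityMeasure (ℤ → EuclideanSpace ℝ (Fin d))) :
        Measure (ℤ → EuclideanSpace ℝ (Fin d))) | μ ∈ range ρ} := by
    rw [isTightMeasureSet_iff_exists_isCompact_measure_compl_le]
    intro ε hε
    obtain ⟨δ, hδ, hδε⟩ := ENNReal.exists_pos_sum_of_countable hε.ne' ℤ
    choose M hM0 hM using fun t : ℤ => htail.exists_ratio_le hα (hX 0).norm
      (NNReal.coe_pos.2 (hδ t))
    refine ⟨univ.pi fun t => Metric.closedBall 0 (M t),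
      isCompact_univ_pi fun t => isCompact_closedBall _ _, ?_⟩
    rintro _ ⟨_, ⟨n, rfl⟩, rfl⟩
    have hK : MeasurableSet (univ.pi fun t => Metric.closedBall
        (0 : EuclideanSpace ℝ (Fin d)) (M t)) :=
      MeasurableSet.univ_pi fun t => measurableSet_closedBall
    have hlevel : (0 : ℝ) < (n : ℝ) + 1 := by positivity
    simp only [ρ, ProbabilityMeasure.coe_mk]
    rw [Measure.map_apply hm hK.compl]
    calc (P[|{ω | (n : ℝ) + 1 < ‖X 0 ω‖}]) _
        ≤ (P[|{ω | (n : ℝ) + 1 < ‖X 0 ω‖}])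
            (⋃ t, {ω | M t < ‖‖X 0 ω‖⁻¹ • X t ω‖}) := by
          refine measure_mono fun ω hω => ?_
          simp only [mem_preimage, mem_compl_iff, mem_univ_pi, not_forall,
            mem_closedBall_zero_iff, not_le] at hω
          exact mem_iUnion.2 hω
      _ ≤ ∑' t, (P[|{ω | (n : ℝ) + 1 < ‖X 0 ω‖}]) {ω | M t < ‖‖X 0 ω‖⁻¹ • X t ω‖} :=
          measure_iUnion_le _
      _ ≤ ∑' t, (δ t : ℝ≥0∞) := by
          refine ENNReal.tsum_le_tsum fun t => ?_
          rw [← ENNReal.ofReal_coe_nnreal, ← ofReal_measureReal]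
          refine ENNReal.ofReal_le_ofReal (le_trans ?_ (hM t n))
          rw [measureReal_def, cond_apply (hRm _), ENNReal.toReal_mul, ENNReal.toReal_inv,
            ← measureReal_def, ← measureReal_def, ← div_eq_inv_mul]
          refine div_le_div_of_nonneg_right ?_ measureReal_nonneg
          rw [← hst.tail_eq hX t]
          refine measureReal_mono fun ω hω => ?_
          have h1 : (n : ℝ) + 1 < ‖X 0 ω‖ := hω.1
          have h2 : M t < ‖‖X 0 ω‖⁻¹ • X t ω‖ := hω.2
          rw [norm_smul, norm_inv, norm_norm, lt_inv_mul_iff₀ (hlevel.trans h1)] at h2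
          refine lt_of_le_of_lt ?_ h2
          rw [mul_comm]
          exact mul_le_mul_of_nonneg_right h1.le (hM0 t).le
      _ ≤ ε := hδε.le
  obtain ⟨Q, -, hQ⟩ := (isCompact_closure_of_isTightMeasureSet htight).ultrafilter_le_nhds'
    ((Ultrafilter.of atTop).map ρ) (Ultrafilter.mem_map.2 (Filter.mem_of_superset univ_mem
      fun n _ => subset_closure (mem_range_self n)))
  refine ⟨Q, inferInstance, fun k f => ?_⟩
  obtain ⟨l, hl⟩ := exists_tendsto_spectral hα hX hst hRV k f
  let f' : (ℤ → EuclideanSpace ℝ (Fin d)) →ᵇ ℝ := f.compContinuous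
    ⟨fun θ t => θ t, continuous_pi fun t => continuous_apply _⟩
  have h1 := ProbabilityMeasure.tendsto_iff_forall_integral_tendsto.1
    (show Tendsto ρ ((Ultrafilter.of atTop : Ultrafilter ℕ) : Filter ℕ) (𝓝 Q) from hQ) f'
  have h2 : Tendsto (fun n => ∫ θ, f' θ ∂(ρ n : Measure (ℤ → EuclideanSpace ℝ (Fin d)))) atTop
      (𝓝 l) := by
    refine (hl.comp (tendsto_atTop_add_const_right _ (1 : ℝ)
      tendsto_natCast_atTop_atTop)).congr fun n => ?_
    simp only [ρ, ProbabilityMeasure.coe_mk, Function.comp]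
    rw [integral_map hm.aemeasurable f'.continuous.measurable.aestronglyMeasurable,
      integral_cond_eq_div]
    rfl
  have h3 : ∫ θ, f (fun t => θ t) ∂(Q : Measure (ℤ → EuclideanSpace ℝ (Fin d))) = l :=
    tendsto_nhds_unique h1 (h2.mono_left (Ultrafilter.of_le _))
  rw [h3]
  exact hl.congr fun x => (integral_cond_eq_div _ _ _).symm

/-! ### The tail process -/

/-- Given a large value of `|X_0|`, the rescaled radius and the angular parts at the times in
`[-k, k]` converge jointly to a Pareto variable and the independent spectral tail process. -/
theorem IsSpectralTailLaw.polarTail {α : ℝ} {Q : Measure (ℤ → EuclideanSpace ℝ (Fin d))}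
    (hQ : IsSpectralTailLaw P X Q) (hX : ∀ t, Measurable (X t)) (hst : StrictlyStationary P X)
    (hRV : RegularlyVaryingSeq P α X) (k : ℕ) :
    PolarTail P α (fun ω => ‖X 0 ω‖)
      (fun ω (t : Finset.Icc (-(k : ℤ)) k) => ‖X 0 ω‖⁻¹ • X t ω)
      (Q.map fun θ (t : Finset.Icc (-(k : ℤ)) k) => θ t) := by
  have htail := hRV.exists_polarTail_norm hst hX
  have hpos := htail.measureReal_pos
  intro u hu f
  have hres : Measurable fun (θ : ℤ → EuclideanSpace ℝ (Fin d))
      (t : Finset.Icc (-(k : ℤ)) k) => θ t :=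
    measurable_pi_lambda _ fun t => measurable_pi_apply _
  have hmap : ∫ s, f s ∂(Q.map fun θ (t : Finset.Icc (-(k : ℤ)) k) => θ t) =
      ∫ θ, f (fun t => θ t) ∂Q :=
    integral_map hres.aemeasurable f.continuous.measurable.aestronglyMeasurable
  rw [hmap]
  have h1 := (hQ.2 k f).comp (tendsto_id.const_mul_atTop hu)
  refine ((htail.tendsto_ratio hu).mul h1).congr fun x => ?_
  rw [Function.comp_apply, integral_cond_eq_div, mul_comm]
  exact div_mul_div_cancel₀ (hpos (u * x)).ne'

omit [IsProbabilityMeasure P] in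
/-- The spectral tail process starts on the unit sphere. -/
theorem IsSpectralTailLaw.ae_norm_eq_one {Q : Measure (ℤ → EuclideanSpace ℝ (Fin d))}
    (hQ : IsSpectralTailLaw P X Q) (hX : ∀ t, Measurable (X t)) :
    ∀ᵐ θ ∂Q, ‖θ 0‖ = 1 := by
  have := hQ.1
  have h0 : (0 : ℤ) ∈ Finset.Icc (-((0 : ℕ) : ℤ)) (0 : ℕ) := by simp
  let f : (Finset.Icc (-((0 : ℕ) : ℤ)) (0 : ℕ) → EuclideanSpace ℝ (Fin d)) →ᵇ ℝ :=
    BoundedContinuousFunction.ofNormedAddCommGroup (fun z => min 1 |‖z ⟨0, h0⟩‖ - 1|)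
      (by fun_prop) 1 fun z => by
        rw [Real.norm_eq_abs, abs_of_nonneg (le_min zero_le_one (abs_nonneg _))]
        exact min_le_left _ _
  have hf : ∀ z, f z = min 1 |‖z ⟨0, h0⟩‖ - 1| := fun z => rfl
  have h1 : Tendsto (fun _ : ℝ => (0 : ℝ)) atTop (𝓝 (∫ θ, f (fun t => θ t) ∂Q)) := by
    refine (hQ.2 0 f).congr' ?_
    filter_upwards [eventually_ge_atTop 0] with x hx
    refine integral_eq_zero_of_ae ?_
    filter_upwards [ae_cond_mem (μ := P)
      (measurableSet_lt (measurable_const (a := x)) (hX 0).norm)] with ω hω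
    have hne : ‖X 0 ω‖ ≠ 0 := (hx.trans_lt hω).ne'
    rw [hf, norm_smul, norm_inv, norm_norm, inv_mul_cancel₀ hne]
    simp
  have h2 := tendsto_nhds_unique tendsto_const_nhds h1
  have hc : Continuous fun θ : ℤ → EuclideanSpace ℝ (Fin d) =>
      f fun t : Finset.Icc (-((0 : ℕ) : ℤ)) (0 : ℕ) => θ t :=
    f.continuous.comp (continuous_pi fun t => continuous_apply _)
  have hint : Integrable (fun θ : ℤ → EuclideanSpace ℝ (Fin d) =>
      f fun t : Finset.Icc (-((0 : ℕ) : ℤ)) (0 : ℕ) => θ t) Q :=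
    Integrable.of_bound hc.measurable.aestronglyMeasurable ‖f‖
      (ae_of_all _ fun θ => f.norm_coe_le_norm _)
  have hnn : ∀ z, 0 ≤ f z := fun z => by
    rw [hf]
    exact le_min zero_le_one (abs_nonneg _)
  have h3 := (integral_eq_zero_iff_of_nonneg (fun θ => hnn _) hint).1 h2.symm
  filter_upwards [h3] with θ hθ
  have hθ' : min 1 |‖θ 0‖ - 1| = 0 := hθ
  rcases min_choice 1 |‖θ 0‖ - 1| with h | h
  · rw [h] at hθ'
    exact absurd hθ' one_ne_zero
  · rw [h] at hθ'
    linarith [abs_eq_zero.1 hθ']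

end Existence

/-! ### Test functions and point processes on `[-∞, ∞]^d \ {0}` -/

section StateSpace

variable {d : ℕ}

instance : SecondCountableTopology (Punctured d) :=
  inferInstanceAs (SecondCountableTopology ({x | x ≠ 0} : Set (Fin d → EReal)))

instance : LocallyCompactSpace (Punctured d) :=
  (isOpen_ne (x := (0 : Fin d → EReal))).isOpenEmbedding_subtypeVal.locallyCompactSpace

theorem continuous_extend : Continuous (extend : EuclideanSpace ℝ (Fin d) → Fin d → EReal) :=
  continuous_pi fun i => continuous_coe_real_ereal.comp (EuclideanSpace.proj i).continuous

theorem extend_zero : extend (0 : EuclideanSpace ℝ (Fin d)) = 0 := by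
  ext i
  simp [extend]

/-- A test function vanishes near the origin, because the image of its support in `[-∞, ∞]^d` is
compact and does not contain the origin. -/
theorem exists_isOpen_evalAt_eq_zero (g : C_c(Punctured d, ℝ≥0)) :
    ∃ U : Set (EuclideanSpace ℝ (Fin d)), IsOpen U ∧ (∀ x, extend x = 0 → x ∈ U) ∧
      ∀ x ∈ U, evalAt g x = 0 := by
  have hK : IsClosed (Subtype.val '' tsupport g : Set (Fin d → EReal)) :=
    (g.hasCompactSupport.isCompact.image continuous_subtype_val).isClosed
  refine ⟨extend ⁻¹' (Subtype.val '' tsupport g)ᶜ, hK.isOpen_compl.preimage continuous_extend,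
    fun x hx => ?_, fun x hx => ?_⟩
  · rintro ⟨y, -, hy⟩
    exact y.2 (hy.trans hx)
  · unfold evalAt
    split_ifs with h
    · exact image_eq_zero_of_notMem_tsupport fun h' => hx ⟨_, h', rfl⟩
    · rfl

theorem continuous_evalAt (g : C_c(Punctured d, ℝ≥0)) : Continuous (evalAt g) := by
  refine continuous_iff_continuousAt.2 fun x => ?_
  by_cases hx : extend x = 0
  · obtain ⟨U, hU, h0, hz⟩ := exists_isOpen_evalAt_eq_zero g
    have h1 : evalAt g =ᶠ[𝓝 x] fun _ => 0 := by
      filter_upwards [hU.mem_nhds (h0 x hx)] with y hy using hz y hy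
    exact h1.continuousAt
  · have hopen : IsOpen {y : EuclideanSpace ℝ (Fin d) | extend y ≠ 0} :=
      isOpen_ne.preimage continuous_extend
    refine ContinuousOn.continuousAt (s := {y | extend y ≠ 0}) ?_ (hopen.mem_nhds hx)
    rw [continuousOn_iff_continuous_domRestrict]
    have h1 : ({y | extend y ≠ 0} : Set (EuclideanSpace ℝ (Fin d))).domRestrict (evalAt g) =
        fun y => g ⟨extend y.1, y.2⟩ := by
      ext1 y
      exact dif_pos y.2
    rw [h1]
    exact g.continuous.comp ((continuous_extend.comp continuous_subtype_val).subtype_mk _)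

theorem exists_pos_evalAt_eq_zero (g : C_c(Punctured d, ℝ≥0)) :
    ∃ δ : ℝ, 0 < δ ∧ ∀ x, ‖x‖ ≤ δ → evalAt g x = 0 := by
  obtain ⟨U, hU, h0, hz⟩ := exists_isOpen_evalAt_eq_zero g
  obtain ⟨δ, hδ, hsub⟩ := Metric.isOpen_iff.1 hU 0 (h0 0 extend_zero)
  refine ⟨δ / 2, by positivity, fun x hx => hz x (hsub ?_)⟩
  rw [mem_ball_zero_iff]
  linarith

theorem exists_evalAt_le (g : C_c(Punctured d, ℝ≥0)) : ∃ C : ℝ≥0, ∀ x, evalAt g x ≤ C := by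
  obtain ⟨C, hC⟩ := (g.hasCompactSupport.isCompact_range g.continuous).bddAbove
  refine ⟨C, fun x => ?_⟩
  unfold evalAt
  split_ifs with h
  · exact hC ⟨_, rfl⟩
  · exact zero_le

theorem integral_pointMass (x : EuclideanSpace ℝ (Fin d)) (g : C_c(Punctured d, ℝ≥0)) :
    (pointMass x).integral g = evalAt g x := by
  unfold pointMass evalAt
  split_ifs with h
  · exact PointMeasure.integral_dirac _ g
  · simpa using PointMeasure.integral_zero g

variable {Ω : Type*} {X : ℤ → Ω → EuclideanSpace ℝ (Fin d)}

theorem integral_pointProcess (c : ℝ) (n : ℕ) (ω : Ω) (g : C_c(Punctured d, ℝ≥0)) :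
    (pointProcess X c n ω).integral g =
      ((∑ j ∈ Finset.range n, evalAt g (c⁻¹ • X ((j : ℤ) + 1) ω) : ℝ≥0) : ℝ≥0∞) := by
  have h : Finset.Icc 1 n = Finset.Ico 1 (n + 1) := by ext; simp
  unfold pointProcess
  simp only [PointMeasure.integral_sum, integral_pointMass]
  rw [h, Finset.sum_Ico_eq_sum_range, ENNReal.ofNNReal_finsetSum]
  refine Finset.sum_congr (by simp) fun j _ => ?_
  rw [Nat.cast_add, Nat.cast_one, add_comm]

theorem continuous_sum_pointMass {T : Type*} [TopologicalSpace T] (s : Finset ℕ)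
    (u : ℕ → T → EuclideanSpace ℝ (Fin d)) (hu : ∀ t, Continuous (u t)) :
    Continuous fun y => ∑ t ∈ s, pointMass (u t y) :=
  PointMeasure.continuous_iff.2 fun g => by
    simp only [PointMeasure.integral_sum, integral_pointMass]
    exact continuous_finsetSum _ fun t _ => ENNReal.continuous_coe.comp
      ((continuous_evalAt g).comp (hu t))

theorem measurable_pointProcess [MeasurableSpace Ω] (hX : ∀ t, Measurable (X t)) (c : ℝ) (n : ℕ) :
    Measurable (pointProcess X c n) := by
  obtain ⟨F, hF, hFX⟩ : ∃ F : (ℤ → EuclideanSpace ℝ (Fin d)) → PointMeasure (Punctured d),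
      Continuous F ∧ ∀ y, F y = ∑ t ∈ Finset.Icc 1 n, pointMass (c⁻¹ • y (t : ℤ)) := by
    refine ⟨_, continuous_sum_pointMass (Finset.Icc 1 n)
      (fun t (y : ℤ → EuclideanSpace ℝ (Fin d)) => c⁻¹ • y (t : ℤ)) fun t => ?_, fun _ => rfl⟩
    have h : Continuous fun y : ℤ → EuclideanSpace ℝ (Fin d) => y (t : ℤ) :=
      continuous_apply (t : ℤ)
    exact h.const_smul c⁻¹
  have h : pointProcess X c n = fun ω => F fun t => X t ω := by
    funext ω
    rw [hFX, pointProcess]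
  rw [h]
  have hXm : Measurable fun ω t => X t ω := measurable_pi_lambda _ hX
  exact hF.measurable.comp hXm

end StateSpace

/-! ### Telescoping over a block -/

section Block

variable {W : Type*}

/-- The difference `e^{-∑_{1 ≤ j ≤ l} γ(y_j)} - e^{-∑_{0 ≤ j ≤ l} γ(y_j)}`. -/
noncomputable def blockDiff (γ : W → ℝ) (l : ℕ) (y : ℤ → W) : ℝ :=
  Real.exp (-∑ j ∈ Finset.range l, γ (y ((j : ℤ) + 1))) -
    Real.exp (-∑ j ∈ Finset.range (l + 1), γ (y j))

theorem blockDiff_eq (γ : W → ℝ) (l : ℕ) (y : ℤ → W) :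
    blockDiff γ l y = Real.exp (-∑ j ∈ Finset.range l, γ (y ((j : ℤ) + 1))) *
      (1 - Real.exp (-γ (y 0))) := by
  rw [blockDiff, Finset.sum_range_succ', neg_add, Real.exp_add]
  push_cast
  ring

variable {γ : W → ℝ}

theorem exp_neg_sum_le_one (hγ : ∀ w, 0 ≤ γ w) (l : ℕ) (y : ℕ → W) :
    Real.exp (-∑ j ∈ Finset.range l, γ (y j)) ≤ 1 :=
  Real.exp_le_one_iff.2 (neg_nonpos.2 (Finset.sum_nonneg fun _ _ => hγ _))

theorem blockDiff_nonneg (hγ : ∀ w, 0 ≤ γ w) (l : ℕ) (y : ℤ → W) : 0 ≤ blockDiff γ l y := by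
  rw [blockDiff_eq]
  exact mul_nonneg (Real.exp_pos _).le
    (sub_nonneg.2 (Real.exp_le_one_iff.2 (neg_nonpos.2 (hγ _))))

theorem blockDiff_le_one (hγ : ∀ w, 0 ≤ γ w) (l : ℕ) (y : ℤ → W) : blockDiff γ l y ≤ 1 := by
  have := exp_neg_sum_le_one hγ l fun j => y ((j : ℤ) + 1)
  have := (Real.exp_pos (-∑ j ∈ Finset.range (l + 1), γ (y j))).le
  rw [blockDiff]
  linarith

theorem blockDiff_eq_zero {l : ℕ} {y : ℤ → W} (h : γ (y 0) = 0) : blockDiff γ l y = 0 := by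
  rw [blockDiff_eq, h]
  simp

theorem abs_blockDiff_sub_le_one (hγ : ∀ w, 0 ≤ γ w) (k l : ℕ) (y : ℤ → W) :
    |blockDiff γ l y - blockDiff γ k y| ≤ 1 := by
  rw [abs_le]
  constructor <;> linarith [blockDiff_nonneg hγ l y, blockDiff_le_one hγ l y,
    blockDiff_nonneg hγ k y, blockDiff_le_one hγ k y]

theorem blockDiff_eq_of_eq_zero {k l : ℕ} (hkl : k ≤ l) {y : ℤ → W}
    (h : ∀ j : ℕ, k ≤ j → j < l → γ (y ((j : ℤ) + 1)) = 0) :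
    blockDiff γ l y = blockDiff γ k y := by
  rw [blockDiff_eq, blockDiff_eq]
  congr 3
  refine (Finset.sum_subset (Finset.range_mono hkl) fun j hj hj' => h j ?_ ?_).symm
  · simpa using hj'
  · simpa using hj

variable [MeasurableSpace W]

theorem measurable_exp_neg_sum (hγm : Measurable γ) (l : ℕ) (i : ℕ → ℤ) :
    Measurable fun y : ℤ → W => Real.exp (-∑ j ∈ Finset.range l, γ (y (i j))) :=
  Real.measurable_exp.comp
    (Finset.measurable_fun_sum _ fun j _ => hγm.comp (measurable_pi_apply (i j))).neg

theorem measurable_blockDiff (hγm : Measurable γ) (l : ℕ) :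
    Measurable (blockDiff γ l : (ℤ → W) → ℝ) :=
  (measurable_exp_neg_sum hγm l fun j => (j : ℤ) + 1).sub
    (measurable_exp_neg_sum hγm (l + 1) fun j => j)

variable {Ω : Type*} [MeasurableSpace Ω] {P : Measure Ω} [IsProbabilityMeasure P]
  {X : ℤ → Ω → W}

theorem integrable_exp_neg_sum (hX : ∀ t, Measurable (X t)) (hγ : ∀ w, 0 ≤ γ w)
    (hγm : Measurable γ) (l : ℕ) (i : ℕ → ℤ) :
    Integrable (fun ω => Real.exp (-∑ j ∈ Finset.range l, γ (X (i j) ω))) P := by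
  refine Integrable.of_bound ((measurable_exp_neg_sum hγm l i).comp
    (measurable_pi_lambda (fun ω t => X t ω) hX)).aestronglyMeasurable 1 (ae_of_all _ fun ω => ?_)
  rw [Real.norm_eq_abs, Real.abs_exp]
  exact exp_neg_sum_le_one hγ l fun j => X (i j) ω

theorem integrable_blockDiff (hX : ∀ t, Measurable (X t)) (hγ : ∀ w, 0 ≤ γ w)
    (hγm : Measurable γ) (l : ℕ) : Integrable (fun ω => blockDiff γ l fun t => X t ω) P :=
  (integrable_exp_neg_sum hX hγ hγm l fun j => (j : ℤ) + 1).sub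
    (integrable_exp_neg_sum hX hγ hγm (l + 1) fun j => j)

/-- The variables of a block are removed one at a time. By stationarity the sum over `0 ≤ j ≤ l` may
be shifted to `1 ≤ j ≤ l + 1`, so the mean of `blockDiff γ l` is the difference of the Laplace
functionals of blocks of lengths `l` and `l + 1`. -/
theorem StrictlyStationary.one_sub_integral_exp_eq_sum (hst : StrictlyStationary P X)
    (hX : ∀ t, Measurable (X t)) (hγ : ∀ w, 0 ≤ γ w) (hγm : Measurable γ) (m : ℕ) :
    1 - ∫ ω, Real.exp (-∑ j ∈ Finset.range m, γ (X ((j : ℤ) + 1) ω)) ∂P =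
      ∑ l ∈ Finset.range m, ∫ ω, blockDiff γ l (fun t => X t ω) ∂P := by
  induction m with
  | zero => simp
  | succ m ih =>
    rw [Finset.sum_range_succ, ← ih]
    have h1 := hst.integral_shift hX 1 (measurable_exp_neg_sum hγm (m + 1) fun j => j)
    have h2 := integral_sub (integrable_exp_neg_sum (P := P) hX hγ hγm m fun j => (j : ℤ) + 1)
      (integrable_exp_neg_sum (P := P) hX hγ hγm (m + 1) fun j => j)
    unfold blockDiff
    rw [h2, ← h1]
    ring

/-- Replacing the differences over a block of length `m` by the difference at lag `k`. The error is
governed by the probability of two exceedances of the level `x` at a distance of `k` or more. -/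
theorem StrictlyStationary.abs_one_sub_integral_exp_sub_le {W : Type*} [NormedAddCommGroup W]
    [MeasurableSpace W] [BorelSpace W] {γ : W → ℝ} {X : ℤ → Ω → W} (hst : StrictlyStationary P X)
    (hX : ∀ t, Measurable (X t)) (hγ : ∀ w, 0 ≤ γ w) (hγm : Measurable γ) {x : ℝ}
    (hγx : ∀ w, ‖w‖ ≤ x → γ w = 0) (k m : ℕ) :
    |1 - ∫ ω, Real.exp (-∑ j ∈ Finset.range m, γ (X ((j : ℤ) + 1) ω)) ∂P -
        m * ∫ ω, blockDiff γ k (fun t => X t ω) ∂P| ≤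
      k * P.real {ω | x < ‖X 0 ω‖} +
        m * P.real ({ω | x < ‖X 0 ω‖} ∩ {ω | ∃ j ∈ Finset.Icc (k : ℤ) m, x < ‖X j ω‖}) := by
  have hS0 : MeasurableSet {ω | x < ‖X 0 ω‖} := measurableSet_lt measurable_const (hX 0).norm
  have hS1 : MeasurableSet {ω | ∃ j ∈ Finset.Icc (k : ℤ) m, x < ‖X j ω‖} := by
    have : {ω | ∃ j ∈ Finset.Icc (k : ℤ) m, x < ‖X j ω‖} =
        ⋃ j ∈ Finset.Icc (k : ℤ) m, {ω | x < ‖X j ω‖} := by ext; simp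
    rw [this]
    exact Finset.measurableSet_biUnion _ fun j _ => measurableSet_lt measurable_const (hX j).norm
  have hbound : ∀ (l : ℕ) (S : Set Ω), MeasurableSet S →
      (∀ ω, ω ∉ S → blockDiff γ l (fun t => X t ω) = blockDiff γ k (fun t => X t ω)) →
      |∫ ω, blockDiff γ l (fun t => X t ω) ∂P - ∫ ω, blockDiff γ k (fun t => X t ω) ∂P| ≤
        P.real S := by
    intro l S hS hSeq
    rw [← integral_sub (integrable_blockDiff hX hγ hγm l) (integrable_blockDiff hX hγ hγm k)]
    calc _ ≤ ∫ ω, |blockDiff γ l (fun t => X t ω) - blockDiff γ k (fun t => X t ω)| ∂P :=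
          abs_integral_le_integral_abs
      _ ≤ ∫ ω, S.indicator (fun _ => (1 : ℝ)) ω ∂P := by
          refine integral_mono ((integrable_blockDiff hX hγ hγm l).sub
            (integrable_blockDiff hX hγ hγm k)).abs ((integrable_const _).indicator hS) fun ω => ?_
          by_cases hω : ω ∈ S
          · simpa [hω] using abs_blockDiff_sub_le_one hγ k l fun t => X t ω
          · simp [hω, hSeq ω hω]
      _ = P.real S := by simp [integral_indicator hS]
  have hout : ∀ (l : ℕ) ω, ω ∉ {ω | x < ‖X 0 ω‖} → blockDiff γ l (fun t => X t ω) = 0 :=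
    fun l ω hω => blockDiff_eq_zero (hγx _ (not_lt.1 hω))
  set p := P.real {ω | x < ‖X 0 ω‖}
  set r := P.real ({ω | x < ‖X 0 ω‖} ∩ {ω | ∃ j ∈ Finset.Icc (k : ℤ) m, x < ‖X j ω‖})
  have hp : 0 ≤ p := measureReal_nonneg
  have hr : 0 ≤ r := measureReal_nonneg
  rw [hst.one_sub_integral_exp_eq_sum hX hγ hγm, ← nsmul_eq_mul, ← Finset.card_range m,
    ← Finset.sum_const, Finset.card_range, ← Finset.sum_sub_distrib]
  calc _ ≤ ∑ l ∈ Finset.range m, |∫ ω, blockDiff γ l (fun t => X t ω) ∂P -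
          ∫ ω, blockDiff γ k (fun t => X t ω) ∂P| := Finset.abs_sum_le_sum_abs _ _
    _ ≤ ∑ l ∈ Finset.range m, ((if l < k then p else 0) + r) := by
        refine Finset.sum_le_sum fun l hl => ?_
        rcases lt_or_ge l k with hlk | hlk
        · rw [if_pos hlk]
          refine (hbound l _ hS0 fun ω hω => ?_).trans (le_add_of_nonneg_right hr)
          rw [hout l ω hω, hout k ω hω]
        · rw [if_neg (not_lt.2 hlk), zero_add]
          refine hbound l _ (hS0.inter hS1) fun ω hω => ?_
          by_cases h0 : ω ∈ {ω | x < ‖X 0 ω‖}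
          · refine blockDiff_eq_of_eq_zero hlk fun j hkj hjl => hγx _ (not_lt.1 fun hj => ?_)
            refine hω ⟨h0, (j : ℤ) + 1, ?_, hj⟩
            have := Finset.mem_range.1 hl
            rw [Finset.mem_Icc]
            omega
          · rw [hout l ω h0, hout k ω h0]
    _ ≤ k * p + m * r := by
        rw [Finset.sum_add_distrib, Finset.sum_const, Finset.card_range, nsmul_eq_mul,
          ← Finset.sum_filter, Finset.sum_const, nsmul_eq_mul]
        gcongr
        calc ((Finset.range m).filter (· < k)).card ≤ (Finset.range k).card :=
              Finset.card_le_card fun l hl => by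
                simpa using (Finset.mem_filter.1 hl).2
          _ = k := Finset.card_range k

end Block

/-! ### The cluster functional -/

theorem tendsto_one_sub_pow_exp_neg {s : ℕ → ℕ} {b : ℕ → ℝ} {κ : ℝ} (hs : Tendsto s atTop atTop)
    (hb : Tendsto (fun n => (s n : ℝ) * b n) atTop (𝓝 κ)) :
    Tendsto (fun n => (1 - b n) ^ s n) atTop (𝓝 (Real.exp (-κ))) := by
  have hs' : Tendsto (fun n => (s n : ℝ)) atTop atTop := tendsto_natCast_atTop_atTop.comp hs
  have hb0 : Tendsto b atTop (𝓝 0) := by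
    refine (hb.div_atTop hs').congr' ?_
    filter_upwards [hs'.eventually_ne_atTop 0] with n hn
    field_simp
  have hlow : Tendsto (fun n => Real.exp (-((s n : ℝ) * b n / (1 - b n)))) atTop
      (𝓝 (Real.exp (-κ))) := by
    have h := hb.div (tendsto_const_nhds.sub hb0) (by norm_num : (1 : ℝ) - 0 ≠ 0)
    rw [sub_zero, div_one] at h
    exact (Real.continuous_exp.tendsto _).comp h.neg
  refine tendsto_of_tendsto_of_tendsto_of_le_of_le' hlow
    ((Real.continuous_exp.tendsto _).comp hb.neg) ?_ ?_
  · filter_upwards [hb0.eventually_lt_const one_pos] with n hn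
    have h1 : 0 < 1 - b n := sub_pos.2 hn
    have h2 : -((s n : ℝ) * b n / (1 - b n)) = s n * (1 - (1 - b n)⁻¹) := by
      field_simp
      ring
    rw [h2, Real.exp_nat_mul]
    refine pow_le_pow_left₀ (Real.exp_pos _).le ?_ _
    rw [← Real.le_log_iff_exp_le h1]
    exact Real.one_sub_inv_le_log_of_pos h1
  · filter_upwards [hb0.eventually_lt_const one_pos] with n hn
    rw [Function.comp_apply, ← mul_neg, Real.exp_nat_mul]
    exact pow_le_pow_left₀ (sub_pos.2 hn).le (Real.one_sub_le_exp_neg _) _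

theorem expNeg_nonneg (s : ℝ≥0∞) : 0 ≤ expNeg s := by
  unfold expNeg
  split_ifs <;> positivity

theorem expNeg_le_one (s : ℝ≥0∞) : expNeg s ≤ 1 := by
  unfold expNeg
  split_ifs
  · exact zero_le_one
  · exact Real.exp_le_one_iff.2 (neg_nonpos.2 ENNReal.toReal_nonneg)

theorem measurable_expNeg : Measurable expNeg :=
  Measurable.ite (measurableSet_singleton ∞) measurable_const
    (Real.measurable_exp.comp ENNReal.measurable_toReal.neg)

theorem tendsto_exp_neg_sum (u : ℕ → ℝ≥0) :
    Tendsto (fun l => Real.exp (-∑ j ∈ Finset.range l, (u j : ℝ))) atTop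
      (𝓝 (expNeg (∑' j, (u j : ℝ≥0∞)))) := by
  unfold expNeg
  split_ifs with h
  · have h1 : ¬ Summable fun j => (u j : ℝ) := by
      rw [NNReal.summable_coe, ← ENNReal.tsum_coe_ne_top_iff_summable, not_not]
      exact h
    exact Real.tendsto_exp_neg_atTop_nhds_zero.comp
      ((not_summable_iff_tendsto_nat_atTop_of_nonneg fun j => (u j).2).1 h1)
  · have h1 : Summable u := ENNReal.tsum_coe_ne_top_iff_summable.1 h
    rw [← ENNReal.coe_tsum h1, ENNReal.coe_toReal, NNReal.coe_tsum]
    exact (Real.continuous_exp.tendsto _).comp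
      (NNReal.summable_coe.2 h1).hasSum.tendsto_sum_nat.neg

section Cluster

variable {W : Type*}

/-- The limit `e^{-∑_{j ≥ 1} γ(y_j)} - e^{-∑_{j ≥ 0} γ(y_j)}` of the differences `blockDiff γ l y`
as `l → ∞`. -/
noncomputable def clusterDiff (γ : W → ℝ≥0) (y : ℤ → W) : ℝ :=
  expNeg (∑' j : ℕ, (γ (y ((j : ℤ) + 1)) : ℝ≥0∞)) - expNeg (∑' j : ℕ, (γ (y (j : ℤ)) : ℝ≥0∞))

theorem tendsto_blockDiff (γ : W → ℝ≥0) (y : ℤ → W) :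
    Tendsto (fun l => blockDiff (fun w => (γ w : ℝ)) l y) atTop (𝓝 (clusterDiff γ y)) :=
  (tendsto_exp_neg_sum fun j => γ (y ((j : ℤ) + 1))).sub
    ((tendsto_exp_neg_sum fun j => γ (y (j : ℤ))).comp (tendsto_add_atTop_nat 1))

theorem abs_clusterDiff_le_one (γ : W → ℝ≥0) (y : ℤ → W) : |clusterDiff γ y| ≤ 1 := by
  have h1 := expNeg_nonneg (∑' j : ℕ, (γ (y ((j : ℤ) + 1)) : ℝ≥0∞))
  have h2 := expNeg_le_one (∑' j : ℕ, (γ (y ((j : ℤ) + 1)) : ℝ≥0∞))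
  have h3 := expNeg_nonneg (∑' j : ℕ, (γ (y (j : ℤ)) : ℝ≥0∞))
  have h4 := expNeg_le_one (∑' j : ℕ, (γ (y (j : ℤ)) : ℝ≥0∞))
  rw [clusterDiff, abs_le]
  constructor <;> linarith

theorem clusterDiff_eq_zero {γ : W → ℝ≥0} {y : ℤ → W} (h : γ (y 0) = 0) : clusterDiff γ y = 0 := by
  refine tendsto_nhds_unique (tendsto_blockDiff γ y) ?_
  have h1 : ∀ l, blockDiff (fun w => (γ w : ℝ)) l y = 0 := fun l =>
    blockDiff_eq_zero (by rw [h]; rfl)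
  simp only [h1]
  exact tendsto_const_nhds

theorem measurable_clusterDiff [MeasurableSpace W] {γ : W → ℝ≥0} (hγ : Measurable γ) :
    Measurable (clusterDiff γ : (ℤ → W) → ℝ) := by
  have h : ∀ t : ℤ, Measurable fun y : ℤ → W => (γ (y t) : ℝ≥0∞) := fun t =>
    (hγ.comp (measurable_pi_apply t)).coe_nnreal_ennreal
  exact (measurable_expNeg.comp (Measurable.tsum fun j : ℕ => h ((j : ℤ) + 1))).sub
    (measurable_expNeg.comp (Measurable.tsum fun j : ℕ => h (j : ℤ)))

theorem continuous_blockDiff [TopologicalSpace W] {γ : W → ℝ} (hγ : Continuous γ) (l : ℕ) :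
    Continuous (blockDiff γ l : (ℤ → W) → ℝ) := by
  have h : ∀ t : ℤ, Continuous fun y : ℤ → W => γ (y t) := fun t => hγ.comp (continuous_apply t)
  have h' : ∀ (l : ℕ) (i : ℕ → ℤ),
      Continuous fun y : ℤ → W => Real.exp (-∑ j ∈ Finset.range l, γ (y (i j))) := fun l i =>
    Real.continuous_exp.comp (continuous_finsetSum _ fun j _ => h (i j)).neg
  exact (h' l fun j => (j : ℤ) + 1).sub (h' (l + 1) fun j => j)

theorem blockDiff_congr {γ : W → ℝ} {l : ℕ} {y z : ℤ → W}
    (h : ∀ t : ℤ, 0 ≤ t → t ≤ l → γ (y t) = γ (z t)) : blockDiff γ l y = blockDiff γ l z := by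
  unfold blockDiff
  congr 3
  · refine Finset.sum_congr rfl fun j hj => h _ (by positivity) ?_
    have := Finset.mem_range.1 hj
    omega
  · refine Finset.sum_congr rfl fun j hj => h _ (by positivity) ?_
    have := Finset.mem_range.1 hj
    omega

end Cluster

section Limit

variable {Ω : Type*} [MeasurableSpace Ω] {P : Measure Ω} [IsProbabilityMeasure P] {d : ℕ}
  {X : ℤ → Ω → EuclideanSpace ℝ (Fin d)} {α : ℝ} {Q : Measure (ℤ → EuclideanSpace ℝ (Fin d))}
  {γ : EuclideanSpace ℝ (Fin d) → ℝ≥0}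

theorem measurable_smul_path :
    Measurable fun (p : ℝ × (ℤ → EuclideanSpace ℝ (Fin d))) (t : ℤ) => p.1 • p.2 t :=
  measurable_pi_lambda _ fun t =>
    measurable_fst.smul ((measurable_pi_apply t).comp measurable_snd)

/-- The mean of a difference at lag `k`, in units of the probability of an exceedance. Since `γ`
vanishes on the unit ball, only the event `|X_0| > x` contributes. -/
theorem IsSpectralTailLaw.tendsto_blockDiff_div (hQ : IsSpectralTailLaw P X Q) (hα : 0 < α)
    (hX : ∀ t, Measurable (X t)) (hst : StrictlyStationary P X) (hRV : RegularlyVaryingSeq P α X)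
    (hγ : Continuous γ) (hγ0 : ∀ w, ‖w‖ ≤ 1 → γ w = 0) (k : ℕ) :
    Tendsto (fun x : ℝ => (∫ ω, blockDiff (fun w => (γ (x⁻¹ • w) : ℝ)) k (fun t => X t ω) ∂P) /
        P.real {ω | x < ‖X 0 ω‖}) atTop
      (𝓝 (∫ p, blockDiff (fun w => (γ w : ℝ)) k (fun t => p.1 • p.2 t)
        ∂((paretoMeasure 1 α).prod Q))) := by
  have := hQ.1
  have := isProbabilityMeasure_paretoMeasure one_pos hα
  let W := EuclideanSpace ℝ (Fin d)
  let I := Finset.Icc (-(k : ℤ)) k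
  have hγr : Continuous fun w => (γ w : ℝ) := NNReal.continuous_coe.comp hγ
  have hγn : ∀ w, (0 : ℝ) ≤ γ w := fun w => (γ w).2
  -- A difference at lag `k` only depends on the coordinates in the window, so the remaining ones
  -- may be set to `0`.
  let path : ℝ × (I → W) → ℤ → W := fun p t => if h : t ∈ I then p.1 • p.2 ⟨t, h⟩ else 0
  have hpath : Continuous path := by
    refine continuous_pi fun t => ?_
    by_cases h : t ∈ I
    · simp only [path, h, dif_pos]
      exact continuous_fst.smul ((continuous_apply _).comp continuous_snd)
    · simp only [path, h, dif_neg, not_false_eq_true]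
      exact continuous_const
  let G : ℝ × (I → W) →ᵇ ℝ := BoundedContinuousFunction.ofNormedAddCommGroup
    (fun p => blockDiff (fun w => (γ w : ℝ)) k (path p))
    ((continuous_blockDiff hγr k).comp hpath) 1 fun p => by
      rw [Real.norm_eq_abs, abs_of_nonneg (blockDiff_nonneg hγn _ _)]
      exact blockDiff_le_one hγn _ _
  have hG : ∀ p, G p = blockDiff (fun w => (γ w : ℝ)) k (path p) := fun p => rfl
  have hmem : ∀ t : ℤ, 0 ≤ t → t ≤ k → t ∈ I := fun t h1 h2 => by
    rw [Finset.mem_Icc]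
    omega
  have hres : Measurable fun (θ : ℤ → W) (t : I) => θ t :=
    measurable_pi_lambda _ fun t => measurable_pi_apply _
  have := Measure.isProbabilityMeasure_map (μ := Q) hres.aemeasurable
  have hS : Measurable fun ω (t : I) => ‖X 0 ω‖⁻¹ • X t ω :=
    measurable_pi_lambda _ fun t => (hX 0).norm.inv.smul (hX t)
  have hmain := (hQ.polarTail hX hst hRV k).tendsto_integral hα (hX 0).norm hS G
  have hmap : ∫ p, G p ∂((paretoMeasure 1 α).prod (Q.map fun (θ : ℤ → W) (t : I) => θ t)) =
      ∫ p, blockDiff (fun w => (γ w : ℝ)) k (fun t => p.1 • p.2 t)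
        ∂((paretoMeasure 1 α).prod Q) := by
    have h1 := Measure.map_prod_map (paretoMeasure 1 α) Q measurable_id hres
    rw [Measure.map_id] at h1
    rw [h1, integral_map (measurable_id.prodMap hres).aemeasurable
      G.continuous.measurable.aestronglyMeasurable]
    refine integral_congr_ae (ae_of_all _ fun p => ?_)
    simp only [hG]
    refine blockDiff_congr fun t h1 h2 => ?_
    simp only [path, hmem t h1 h2, dif_pos, Prod.map, id]
  rw [hmap] at hmain
  refine hmain.congr' ?_
  filter_upwards [eventually_gt_atTop 0] with x hx
  congr 1
  rw [← integral_indicator (measurableSet_lt measurable_const (hX 0).norm)]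
  refine integral_congr_ae (ae_of_all _ fun ω => ?_)
  by_cases hω : x < ‖X 0 ω‖
  · have hne : ‖X 0 ω‖ ≠ 0 := (hx.trans hω).ne'
    simp only [indicator, mem_ofPred_eq, hω, if_true, hG]
    have h1 : blockDiff (fun w => (γ (x⁻¹ • w) : ℝ)) k (fun t => X t ω) =
        blockDiff (fun w => (γ w : ℝ)) k fun t => x⁻¹ • X t ω := rfl
    rw [h1]
    refine blockDiff_congr fun t h1 h2 => ?_
    simp only [path, hmem t h1 h2, dif_pos]
    rw [smul_smul, mul_assoc, mul_inv_cancel₀ hne, mul_one]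
  · simp only [indicator, mem_ofPred_eq, hω, if_false]
    refine (blockDiff_eq_zero ?_).symm
    rw [hγ0]
    · rfl
    · rw [norm_smul, norm_inv, Real.norm_eq_abs, abs_of_pos hx, inv_mul_le_iff₀ hx, mul_one]
      exact not_lt.1 hω

theorem tendsto_integral_blockDiff (μ : Measure (ℝ × (ℤ → EuclideanSpace ℝ (Fin d))))
    [IsProbabilityMeasure μ] (hγ : Measurable γ) :
    Tendsto (fun k : ℕ => ∫ p, blockDiff (fun w => (γ w : ℝ)) k (fun t => p.1 • p.2 t) ∂μ) atTop
      (𝓝 (∫ p, clusterDiff γ (fun t => p.1 • p.2 t) ∂μ)) := by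
  have hγn : ∀ w, (0 : ℝ) ≤ γ w := fun w => (γ w).2
  refine tendsto_integral_of_dominated_convergence (fun _ => 1) (fun k => ?_)
    (integrable_const _) (fun k => ae_of_all _ fun p => ?_)
    (ae_of_all _ fun p => tendsto_blockDiff γ _)
  · exact ((measurable_blockDiff hγ.coe_nnreal_real k).comp
      measurable_smul_path).aestronglyMeasurable
  · rw [Real.norm_eq_abs, abs_of_nonneg (blockDiff_nonneg hγn _ _)]
    exact blockDiff_le_one hγn _ _

end Limit

/-! ### Convergence of the Laplace functionals -/

theorem tendsto_natCast_div_mul_div {m : ℕ → ℕ} (hm : Tendsto m atTop atTop)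
    (hmn : Tendsto (fun n : ℕ => (m n : ℝ) / (n : ℝ)) atTop (𝓝 0)) :
    Tendsto (fun n : ℕ => ((n / m n : ℕ) : ℝ) * (m n / n)) atTop (𝓝 1) := by
  have h1 : Tendsto (fun n : ℕ => 1 - (m n : ℝ) / n) atTop (𝓝 1) := by
    simpa using tendsto_const_nhds.sub hmn
  refine tendsto_of_tendsto_of_tendsto_of_le_of_le' h1 tendsto_const_nhds ?_ ?_
  · filter_upwards [hm.eventually_gt_atTop 0, eventually_gt_atTop 0] with n hmn0 hn0
    have h2 : (n : ℝ) < ((n / m n : ℕ) : ℝ) * m n + m n := by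
      exact_mod_cast (by
        have h3 := Nat.div_add_mod n (m n)
        have h4 := Nat.mod_lt n hmn0
        rw [mul_comm] at h3
        omega : n < n / m n * m n + m n)
    have hn : (0 : ℝ) < n := by exact_mod_cast hn0
    rw [← mul_div_assoc, le_div_iff₀ hn, sub_mul, div_mul_cancel₀ _ hn.ne']
    linarith
  · filter_upwards [eventually_gt_atTop 0] with n hn0
    have hn : (0 : ℝ) < n := by exact_mod_cast hn0
    rw [← mul_div_assoc, div_le_one hn]
    exact_mod_cast Nat.div_mul_le_self n (m n)

theorem tendsto_nat_div_atTop {m : ℕ → ℕ} (hm : Tendsto m atTop atTop)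
    (hmn : Tendsto (fun n : ℕ => (m n : ℝ) / (n : ℝ)) atTop (𝓝 0)) :
    Tendsto (fun n : ℕ => n / m n) atTop atTop := by
  refine (tendsto_natCast_atTop_iff (R := ℝ)).1 ?_
  have h0 : Tendsto (fun n : ℕ => (m n : ℝ) / n) atTop (𝓝[>] 0) := by
    refine tendsto_nhdsWithin_iff.2 ⟨hmn, ?_⟩
    filter_upwards [hm.eventually_gt_atTop 0, eventually_gt_atTop 0] with n h1 h2
    have h1' : (0 : ℝ) < m n := by exact_mod_cast h1
    have h2' : (0 : ℝ) < n := by exact_mod_cast h2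
    exact div_pos h1' h2'
  refine ((tendsto_natCast_div_mul_div hm hmn).pos_mul_atTop one_pos
    h0.inv_tendsto_nhdsGT_zero).congr' ?_
  filter_upwards [h0.eventually self_mem_nhdsWithin] with n hn
  rw [Pi.inv_apply, mul_assoc, mul_inv_cancel₀ (ne_of_gt hn), mul_one]

section Limit

variable {Ω : Type*} [MeasurableSpace Ω] {P : Measure Ω} [IsProbabilityMeasure P] {d : ℕ}
  {X : ℤ → Ω → EuclideanSpace ℝ (Fin d)} {α : ℝ} {Q : Measure (ℤ → EuclideanSpace ℝ (Fin d))}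
  {a : ℕ → ℝ} {m : ℕ → ℕ}

theorem tendsto_atTop_of_tendsto_mul_tail {R : Ω → ℝ} (hR : ∀ x, 0 < P.real {ω | x < R ω})
    (ha : Tendsto (fun n : ℕ => (n : ℝ) * P.real {ω | a n < R ω}) atTop (𝓝 1)) :
    Tendsto a atTop atTop := by
  refine tendsto_atTop.2 fun M => ?_
  have h1 : Tendsto (fun n : ℕ => (n : ℝ) * P.real {ω | M < R ω}) atTop atTop :=
    tendsto_natCast_atTop_atTop.atTop_mul_const (hR M)
  filter_upwards [h1.eventually_gt_atTop 2, ha.eventually_lt_const one_lt_two] with n h2 h3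
  by_contra hcon
  have h4 := mul_le_mul_of_nonneg_left (measureReal_tail_anti (P := P) R (not_le.1 hcon).le)
    (Nat.cast_nonneg n : (0 : ℝ) ≤ n)
  linarith

theorem PolarTail.tendsto_mul_tail {V : Type*} [PseudoEMetricSpace V] [MeasurableSpace V]
    {R : Ω → ℝ} {S : Ω → V} {σ : Measure V} [IsProbabilityMeasure σ] (h : PolarTail P α R S σ)
    (ha : Tendsto (fun n : ℕ => (n : ℝ) * P.real {ω | a n < R ω}) atTop (𝓝 1)) {δ : ℝ}
    (hδ : 0 < δ) :
    Tendsto (fun n : ℕ => (n : ℝ) * P.real {ω | δ * a n < R ω}) atTop (𝓝 (δ ^ (-α))) := by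
  have h1 := (h.tendsto_ratio hδ).comp
    (tendsto_atTop_of_tendsto_mul_tail h.measureReal_pos ha)
  have h2 := ha.mul h1
  rw [one_mul] at h2
  refine h2.congr fun n => ?_
  have := (h.measureReal_pos (a n)).ne'
  simp only [Function.comp]
  field_simp

omit [MeasurableSpace Ω] in
theorem lt_maxNorm_iff {x : ℝ} (hx : 0 ≤ x) (s t : ℤ) (ω : Ω) :
    x < maxNorm X s t ω ↔ ∃ j ∈ Finset.Icc s t, x < ‖X j ω‖ := by
  lift x to ℝ≥0 using hx
  rw [maxNorm, NNReal.coe_lt_coe, Finset.lt_sup_iff]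
  simp only [← NNReal.coe_lt_coe, coe_nnnorm]

/-- The limit of `(n / m_n) (1 - L_n)`, where `L_n` is the Laplace functional of a block of length
`m_n`. The test function is rescaled so that it vanishes on the unit ball and the points are
`X_j / (δ a_n)`. -/
theorem tendsto_mul_one_sub_block (hα : 0 < α) (hX : ∀ t, Measurable (X t))
    (hst : StrictlyStationary P X) (hRV : RegularlyVaryingSeq P α X)
    (hQ : IsSpectralTailLaw P X Q)
    (ha : Tendsto (fun n : ℕ => (n : ℝ) * P.real {ω | a n < ‖X 0 ω‖}) atTop (𝓝 1))
    (hm : Tendsto m atTop atTop) (hac : AntiClustering P X a m) {δ : ℝ} (hδ : 0 < δ)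
    {γ : EuclideanSpace ℝ (Fin d) → ℝ≥0} (hγ : Continuous γ) (hγ0 : ∀ w, ‖w‖ ≤ 1 → γ w = 0) :
    Tendsto (fun n : ℕ => (n : ℝ) / m n * (1 - ∫ ω, Real.exp (-∑ j ∈ Finset.range (m n),
        (γ ((δ * a n)⁻¹ • X ((j : ℤ) + 1) ω) : ℝ)) ∂P)) atTop
      (𝓝 (δ ^ (-α) * ∫ p, clusterDiff γ (fun t => p.1 • p.2 t)
        ∂((paretoMeasure 1 α).prod Q))) := by
  have := hQ.1
  have := isProbabilityMeasure_paretoMeasure one_pos hα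
  have htail := hRV.exists_polarTail_norm hst hX
  have hpos := htail.measureReal_pos
  have hnp := htail.tendsto_mul_tail ha hδ
  have hatop := tendsto_atTop_of_tendsto_mul_tail hpos ha
  have hxtop : Tendsto (fun n => δ * a n) atTop atTop := hatop.const_mul_atTop hδ
  have hm' : Tendsto (fun n => (m n : ℝ)) atTop atTop := tendsto_natCast_atTop_atTop.comp hm
  set c : ℝ := δ ^ (-α) with hc
  have hc0 : 0 < c := by positivity
  set I : ℕ → ℝ := fun k => ∫ p, blockDiff (fun w => (γ w : ℝ)) k (fun t => p.1 • p.2 t)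
    ∂((paretoMeasure 1 α).prod Q)
  set J : ℝ := ∫ p, clusterDiff γ (fun t => p.1 • p.2 t) ∂((paretoMeasure 1 α).prod Q)
  have hIJ : Tendsto I atTop (𝓝 J) := tendsto_integral_blockDiff _ hγ.measurable
  refine Metric.tendsto_nhds.2 fun ε hε => ?_
  -- The lag `k` is fixed first, so that both the truncation of the limit and the probability of
  -- exceedances at lags `k` or more are small.
  obtain ⟨k, hk1, hk2⟩ := (((hIJ.const_mul c).eventually (Metric.ball_mem_nhds _
    (by positivity : 0 < ε / 4))).and ((hac δ hδ).eventually_lt_const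
      (ENNReal.ofReal_pos.2 (by positivity : 0 < ε / (4 * (c + 1)))))).exists
  have hk3 := eventually_lt_of_limsup_lt hk2
  have hEk : Tendsto (fun n : ℕ => (n : ℝ) *
      ∫ ω, blockDiff (fun w => (γ ((δ * a n)⁻¹ • w) : ℝ)) k (fun t => X t ω) ∂P) atTop
      (𝓝 (c * I k)) := by
    refine (hnp.mul ((hQ.tendsto_blockDiff_div hα hX hst hRV hγ hγ0 k).comp hxtop)).congr
      fun n => ?_
    have := (hpos (δ * a n)).ne'
    simp only [Function.comp]
    field_simp
  have hkm : Tendsto (fun n : ℕ => (n : ℝ) * P.real {ω | δ * a n < ‖X 0 ω‖} * (k / m n)) atTop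
      (𝓝 0) := by
    simpa using hnp.mul (tendsto_const_nhds.div_atTop hm')
  filter_upwards [hk3, hEk.eventually (Metric.ball_mem_nhds _ (by positivity : 0 < ε / 4)),
    hkm.eventually_lt_const (by positivity : 0 < ε / 4), hnp.eventually_lt_const (lt_add_one c),
    hxtop.eventually_gt_atTop 0, hm.eventually_gt_atTop 0] with n hn1 hn2 hn3 hn4 hx hmn
  rw [Real.dist_eq] at hk1 hn2
  have hmR : (0 : ℝ) < m n := by exact_mod_cast hmn
  have hγn : ∀ w, (0 : ℝ) ≤ γ ((δ * a n)⁻¹ • w) := fun w => (γ _).2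
  have hγc : Continuous fun w => (γ ((δ * a n)⁻¹ • w) : ℝ) :=
    NNReal.continuous_coe.comp (hγ.comp (continuous_const_smul _))
  have hγx : ∀ w, ‖w‖ ≤ δ * a n → (γ ((δ * a n)⁻¹ • w) : ℝ) = 0 := fun w hw => by
    rw [hγ0]
    · rfl
    · rwa [norm_smul, norm_inv, Real.norm_eq_abs, abs_of_pos hx, inv_mul_le_iff₀ hx, mul_one]
  have herr := hst.abs_one_sub_integral_exp_sub_le hX hγn hγc.measurable hγx k (m n)
  set L : ℝ := ∫ ω, Real.exp (-∑ j ∈ Finset.range (m n),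
    (γ ((δ * a n)⁻¹ • X ((j : ℤ) + 1) ω) : ℝ)) ∂P
  set E : ℝ := ∫ ω, blockDiff (fun w => (γ ((δ * a n)⁻¹ • w) : ℝ)) k (fun t => X t ω) ∂P
  set p : ℝ := P.real {ω | δ * a n < ‖X 0 ω‖} with hp
  set r : ℝ := P.real ({ω | δ * a n < ‖X 0 ω‖} ∩
    {ω | ∃ j ∈ Finset.Icc (k : ℤ) (m n), δ * a n < ‖X j ω‖}) with hr
  have hp0 : 0 < p := hpos _
  have hq : r ≤ p * (ε / (4 * (c + 1))) := by
    have h1 : {ω | δ * a n < maxNorm X k (m n) ω} =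
        {ω | ∃ j ∈ Finset.Icc (k : ℤ) (m n), δ * a n < ‖X j ω‖} := by
      ext ω
      exact lt_maxNorm_iff hx.le _ _ ω
    rw [h1, cond_apply (measurableSet_lt measurable_const (hX 0).norm)] at hn1
    have h2 := ENNReal.toReal_mono ENNReal.ofReal_ne_top hn1.le
    rw [ENNReal.toReal_mul, ENNReal.toReal_inv, ENNReal.toReal_ofReal (by positivity),
      ← measureReal_def, ← measureReal_def, ← hp, ← hr] at h2
    rwa [inv_mul_le_iff₀ hp0] at h2
  have hA : |(n : ℝ) / m n * (1 - L) - n * E| ≤ ε / 4 + ε / 4 := by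
    have h1 : (n : ℝ) / m n * (1 - L) - n * E = n / m n * (1 - L - m n * E) := by
      field_simp
    rw [h1, abs_mul, abs_of_nonneg (by positivity : (0 : ℝ) ≤ n / m n)]
    calc (n : ℝ) / m n * |1 - L - m n * E| ≤ n / m n * (k * p + m n * r) :=
          mul_le_mul_of_nonneg_left herr (by positivity)
      _ = n * p * (k / m n) + n * r := by field_simp
      _ ≤ n * p * (k / m n) + n * (p * (ε / (4 * (c + 1)))) := by gcongr
      _ = n * p * (k / m n) + (n * p) * (ε / (4 * (c + 1))) := by ring
      _ ≤ ε / 4 + (c + 1) * (ε / (4 * (c + 1))) :=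
          add_le_add hn3.le (mul_le_mul_of_nonneg_right hn4.le (by positivity))
      _ = ε / 4 + ε / 4 := by field_simp
  rw [Real.dist_eq]
  rw [abs_lt] at hk1 hn2 ⊢
  rw [abs_le] at hA
  constructor <;> linarith [hA.1, hA.2, hk1.1, hk1.2, hn2.1, hn2.2]

theorem clusterIntegrand_eq (g : C_c(Punctured d, ℝ≥0)) (y : ℝ) :
    clusterIntegrand α Q g y =
      (∫ θ, clusterDiff (evalAt g) (fun t => y • θ t) ∂Q) * (α * y ^ (-α - 1)) := rfl

theorem measurable_integral_clusterDiff [IsProbabilityMeasure Q] (g : C_c(Punctured d, ℝ≥0)) :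
    Measurable fun y : ℝ => ∫ θ, clusterDiff (evalAt g) (fun t => y • θ t) ∂Q := by
  have h : Measurable fun p : ℝ × (ℤ → EuclideanSpace ℝ (Fin d)) =>
      clusterDiff (evalAt g) (fun t => p.1 • p.2 t) :=
    (measurable_clusterDiff (continuous_evalAt g).measurable).comp measurable_smul_path
  exact (StronglyMeasurable.integral_prod_right (ν := Q)
    (f := fun y θ => clusterDiff (evalAt g) (fun t => y • θ t)) h.stronglyMeasurable).measurable

theorem abs_integral_clusterDiff_le_one [IsProbabilityMeasure Q] (g : C_c(Punctured d, ℝ≥0))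
    (y : ℝ) : |∫ θ, clusterDiff (evalAt g) (fun t => y • θ t) ∂Q| ≤ 1 := by
  have h := norm_integral_le_of_norm_le_const (μ := Q) (C := 1)
    (f := fun θ => clusterDiff (evalAt g) fun t => y • θ t)
    (ae_of_all _ fun θ => abs_clusterDiff_le_one (evalAt g) fun t => y • θ t)
  simpa using h

/-- A test function vanishes on a ball around the origin, and `|Θ_0| = 1`, so the integrand
vanishes near `0`. -/
theorem clusterIntegrand_eq_zero (hΘ : ∀ᵐ θ ∂Q, ‖θ 0‖ = 1) {g : C_c(Punctured d, ℝ≥0)} {δ : ℝ}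
    (hδ : ∀ x, ‖x‖ ≤ δ → evalAt g x = 0) {y : ℝ} (hy0 : 0 ≤ y) (hy : y ≤ δ) :
    clusterIntegrand α Q g y = 0 := by
  rw [clusterIntegrand_eq, integral_eq_zero_of_ae, zero_mul]
  filter_upwards [hΘ] with θ hθ
  refine clusterDiff_eq_zero (hδ _ ?_)
  rwa [norm_smul, hθ, mul_one, Real.norm_eq_abs, abs_of_nonneg hy0]

theorem integrableOn_clusterIntegrand [IsProbabilityMeasure Q] (hα : 0 < α)
    (hΘ : ∀ᵐ θ ∂Q, ‖θ 0‖ = 1) (g : C_c(Punctured d, ℝ≥0)) :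
    IntegrableOn (clusterIntegrand α Q g) (Ioi 0) := by
  obtain ⟨δ, hδ, hg⟩ := exists_pos_evalAt_eq_zero g
  rw [← Ioc_union_Ioi_eq_Ioi hδ.le]
  refine IntegrableOn.union ?_ ?_
  · refine integrableOn_zero.congr_fun (fun y hy => ?_) measurableSet_Ioc
    exact (clusterIntegrand_eq_zero hΘ hg hy.1.le hy.2).symm
  · have h1 : IntegrableOn (fun y : ℝ => α * y ^ (-α - 1)) (Ioi δ) :=
      (integrableOn_Ioi_rpow_of_lt (by linarith) hδ).const_mul α
    exact h1.bdd_mul (measurable_integral_clusterDiff g).aestronglyMeasurable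
      (ae_of_all _ fun y => abs_integral_clusterDiff_le_one g y)

/-- The change of variables `y ↦ δ y` which normalizes the level of the exceedances to `1`. -/
theorem rpow_mul_integral_clusterDiff [IsProbabilityMeasure Q] (hα : 0 < α)
    (hΘ : ∀ᵐ θ ∂Q, ‖θ 0‖ = 1) {g : C_c(Punctured d, ℝ≥0)} {δ : ℝ} (hδ : 0 < δ)
    (hg : ∀ x, ‖x‖ ≤ δ → evalAt g x = 0) :
    δ ^ (-α) * ∫ p, clusterDiff (fun w => evalAt g (δ • w)) (fun t => p.1 • p.2 t)
      ∂((paretoMeasure 1 α).prod Q) = ∫ y in Ioi 0, clusterIntegrand α Q g y := by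
  have := isProbabilityMeasure_paretoMeasure one_pos hα
  have hm : Measurable fun p : ℝ × (ℤ → EuclideanSpace ℝ (Fin d)) =>
      clusterDiff (fun w => evalAt g (δ • w)) (fun t => p.1 • p.2 t) :=
    (measurable_clusterDiff ((continuous_evalAt g).comp
      (continuous_const_smul δ)).measurable).comp measurable_smul_path
  have hint : Integrable (fun p : ℝ × (ℤ → EuclideanSpace ℝ (Fin d)) =>
      clusterDiff (fun w => evalAt g (δ • w)) (fun t => p.1 • p.2 t))
      ((paretoMeasure 1 α).prod Q) :=
    Integrable.of_bound hm.aestronglyMeasurable 1 (ae_of_all _ fun p => abs_clusterDiff_le_one _ _)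
  have hscale : ∀ (y : ℝ) (θ : ℤ → EuclideanSpace ℝ (Fin d)),
      clusterDiff (fun w => evalAt g (δ • w)) (fun t => y • θ t) =
        clusterDiff (evalAt g) (fun t => (δ * y) • θ t) := fun y θ => by
    simp only [clusterDiff, smul_smul]
  rw [integral_prod _ hint, integral_paretoMeasure_one hα]
  have h1 := integral_comp_mul_left_Ioi (clusterIntegrand α Q g) 1 hδ
  rw [mul_one, smul_eq_mul, eq_inv_mul_iff_mul_eq₀ hδ.ne'] at h1
  have h2 : ∫ y in Ioi 0, clusterIntegrand α Q g y = ∫ y in Ioi δ, clusterIntegrand α Q g y := by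
    refine (setIntegral_eq_of_subset_of_forall_sdiff_eq_zero measurableSet_Ioi
      (Ioi_subset_Ioi hδ.le) fun y hy => ?_)
    exact clusterIntegrand_eq_zero hΘ hg (le_of_lt hy.1) (not_lt.1 hy.2)
  rw [h2, ← h1, ← integral_const_mul, ← integral_const_mul]
  refine setIntegral_congr_fun measurableSet_Ioi fun y (hy : 1 < y) => ?_
  have hpow : (δ * y) ^ (-α - 1) = δ ^ (-α) * δ⁻¹ * y ^ (-α - 1) := by
    rw [Real.mul_rpow hδ.le (by linarith), Real.rpow_sub hδ, Real.rpow_one, div_eq_mul_inv]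
  simp only [clusterIntegrand_eq, hscale, hpow]
  field_simp

omit [IsProbabilityMeasure P] in
theorem laplace_pointProcess (c : ℝ) (n : ℕ) (g : C_c(Punctured d, ℝ≥0)) :
    laplace P (pointProcess X c n) g =
      ∫ ω, Real.exp (-∑ j ∈ Finset.range n, (evalAt g (c⁻¹ • X ((j : ℤ) + 1) ω) : ℝ)) ∂P := by
  simp only [laplace, integral_pointProcess, ENNReal.coe_toReal, NNReal.coe_sum]

/-- Blocking: the mixing condition reduces the Laplace functional of `N_n` to a power of that of a
block, with exponent `k_n = [n / m_n]`. -/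
theorem IsSpectralTailLaw.tendsto_laplace (hα : 0 < α) (hX : ∀ t, Measurable (X t))
    (hst : StrictlyStationary P X) (hRV : RegularlyVaryingSeq P α X)
    (hQ : IsSpectralTailLaw P X Q)
    (ha : Tendsto (fun n : ℕ => (n : ℝ) * P.real {ω | a n < ‖X 0 ω‖}) atTop (𝓝 1))
    (hm : Tendsto m atTop atTop)
    (hmn : Tendsto (fun n : ℕ => (m n : ℝ) / (n : ℝ)) atTop (𝓝 0))
    (hmix : MixingCondition P X a m) (hac : AntiClustering P X a m) (g : C_c(Punctured d, ℝ≥0)) :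
    Tendsto (fun n => laplace P (pointProcess X (a n) n) g) atTop
      (𝓝 (Real.exp (-∫ y in Ioi 0, clusterIntegrand α Q g y))) := by
  have := hQ.1
  obtain ⟨δ, hδ, hg⟩ := exists_pos_evalAt_eq_zero g
  have hγ0 : ∀ w : EuclideanSpace ℝ (Fin d), ‖w‖ ≤ 1 → evalAt g (δ • w) = 0 := fun w hw => by
    refine hg _ ?_
    rw [norm_smul, Real.norm_eq_abs, abs_of_pos hδ]
    exact mul_le_of_le_one_right hδ.le hw
  have h1 := tendsto_mul_one_sub_block hα hX hst hRV hQ ha hm hac hδ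
    ((continuous_evalAt g).comp (continuous_const_smul δ)) hγ0
  have hlap : ∀ n, ∫ ω, Real.exp (-∑ j ∈ Finset.range (m n),
      ((evalAt g ∘ fun w => δ • w) ((δ * a n)⁻¹ • X ((j : ℤ) + 1) ω) : ℝ)) ∂P =
        laplace P (pointProcess X (a n) (m n)) g := fun n => by
    rw [laplace_pointProcess]
    simp only [Function.comp, smul_smul, mul_inv, mul_inv_cancel_left₀ hδ.ne']
  simp only [hlap] at h1
  have h2 : Tendsto (fun n => ((n / m n : ℕ) : ℝ) *
      (1 - laplace P (pointProcess X (a n) (m n)) g)) atTop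
      (𝓝 (∫ y in Ioi 0, clusterIntegrand α Q g y)) := by
    have h3 := (tendsto_natCast_div_mul_div hm hmn).mul h1
    rw [one_mul] at h3
    rw [← rpow_mul_integral_clusterDiff hα (hQ.ae_norm_eq_one hX) hδ hg]
    refine h3.congr' ?_
    filter_upwards [hm.eventually_gt_atTop 0, eventually_gt_atTop 0] with n h4 h5
    have h4' : (0 : ℝ) < m n := by exact_mod_cast h4
    have h5' : (0 : ℝ) < n := by exact_mod_cast h5
    field_simp
  have h3 := (hmix g).add (tendsto_one_sub_pow_exp_neg (tendsto_nat_div_atTop hm hmn) h2)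
  rw [zero_add] at h3
  exact h3.congr fun n => by ring

/-- The mean of the integral of a test function is bounded uniformly in `n`. -/
theorem exists_lintegral_pointProcess_le (hX : ∀ t, Measurable (X t))
    (hst : StrictlyStationary P X) (hRV : RegularlyVaryingSeq P α X)
    (ha : Tendsto (fun n : ℕ => (n : ℝ) * P.real {ω | a n < ‖X 0 ω‖}) atTop (𝓝 1))
    (g : C_c(Punctured d, ℝ≥0)) :
    ∃ C : ℝ≥0, ∀ n, ∫⁻ ω, (pointProcess X (a n) n ω).integral g ∂P ≤ C := by
  obtain ⟨C, hC⟩ := exists_evalAt_le g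
  obtain ⟨δ, hδ, hg⟩ := exists_pos_evalAt_eq_zero g
  have htail := hRV.exists_polarTail_norm hst hX
  have hms : ∀ c : ℝ, MeasurableSet {w : EuclideanSpace ℝ (Fin d) | evalAt g (c⁻¹ • w) ≠ 0} :=
    fun c => (((continuous_evalAt g).comp (continuous_const_smul c⁻¹)).measurable
      (measurableSet_singleton 0)).compl
  set p : ℕ → ℝ := fun n => P.real {ω | evalAt g ((a n)⁻¹ • X 0 ω) ≠ 0}
  obtain ⟨B, hB⟩ : BddAbove (range fun n : ℕ => (n : ℝ) * p n) := by
    refine IsBoundedUnder.bddAbove_range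
      ((htail.tendsto_mul_tail ha hδ).isBoundedUnder_le.mono_le ?_)
    filter_upwards [(tendsto_atTop_of_tendsto_mul_tail htail.measureReal_pos
      ha).eventually_gt_atTop 0] with n hn
    refine mul_le_mul_of_nonneg_left (measureReal_mono fun ω hω => ?_) (Nat.cast_nonneg n)
    by_contra hcon
    refine hω (hg _ ?_)
    rw [norm_smul, norm_inv, Real.norm_eq_abs, abs_of_pos hn, inv_mul_le_iff₀ hn, mul_comm]
    exact not_lt.1 hcon
  refine ⟨C * B.toNNReal, fun n => ?_⟩
  have hterm : ∀ t : ℤ,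
      ∫⁻ ω, (evalAt g ((a n)⁻¹ • X t ω) : ℝ≥0∞) ∂P ≤ C * ENNReal.ofReal (p n) := by
    intro t
    have hmt : MeasurableSet {ω | evalAt g ((a n)⁻¹ • X t ω) ≠ 0} := hX t (hms (a n))
    have h0 : Measurable fun y : ℤ → EuclideanSpace ℝ (Fin d) => y 0 := measurable_pi_apply 0
    have hshift := hst.measureReal_shift hX t
      (B := {y | evalAt g ((a n)⁻¹ • y 0) ≠ 0}) (h0 (hms (a n)))
    simp only [mem_ofPred_eq, zero_add] at hshift
    calc ∫⁻ ω, (evalAt g ((a n)⁻¹ • X t ω) : ℝ≥0∞) ∂P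
        ≤ ∫⁻ ω, {ω | evalAt g ((a n)⁻¹ • X t ω) ≠ 0}.indicator (fun _ => (C : ℝ≥0∞)) ω ∂P := by
          refine lintegral_mono fun ω => ?_
          by_cases h : evalAt g ((a n)⁻¹ • X t ω) = 0
          · simp [h]
          · simpa [indicator, h] using hC _
      _ = C * ENNReal.ofReal (p n) := by
          have h1 : p n = P.real {ω | evalAt g ((a n)⁻¹ • X t ω) ≠ 0} := hshift.symm
          rw [lintegral_indicator_const hmt, h1, ofReal_measureReal]
  have hmeas : ∀ t : ℤ, Measurable fun ω => (evalAt g ((a n)⁻¹ • X t ω) : ℝ≥0∞) := fun t =>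
    (((continuous_evalAt g).comp (continuous_const_smul (a n)⁻¹)).measurable.comp
      (hX t)).coe_nnreal_ennreal
  calc ∫⁻ ω, (pointProcess X (a n) n ω).integral g ∂P
      = ∑ j ∈ Finset.range n, ∫⁻ ω, (evalAt g ((a n)⁻¹ • X ((j : ℤ) + 1) ω) : ℝ≥0∞) ∂P := by
        simp only [integral_pointProcess, ENNReal.ofNNReal_finsetSum]
        exact lintegral_finsetSum _ fun j _ => hmeas _
    _ ≤ ∑ _j ∈ Finset.range n, C * ENNReal.ofReal (p n) := Finset.sum_le_sum fun j _ => hterm _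
    _ = C * ENNReal.ofReal (n * p n) := by
        rw [Finset.sum_const, Finset.card_range, nsmul_eq_mul,
          ENNReal.ofReal_mul (Nat.cast_nonneg n), ENNReal.ofReal_natCast]
        ring
    _ ≤ ((C * B.toNNReal : ℝ≥0) : ℝ≥0∞) := by
        rw [ENNReal.coe_mul]
        exact mul_le_mul_right (ENNReal.ofReal_le_ofReal (hB ⟨n, rfl⟩)) _

end Limit

end HeavyTail

theorem theorem4p1 {Ω : Type*} [MeasurableSpace Ω] (P : Measure Ω) [IsProbabilityMeasure P]
    (d : ℕ) (hd : 1 ≤ d) (X : ℤ → Ω → EuclideanSpace ℝ (Fin d)) (hX : ∀ t, Measurable (X t))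
    (hstat : StrictlyStationary P X)
    (α : ℝ) (hα : 0 < α) (hRV : RegularlyVaryingSeq P α X)
    (a : ℕ → ℝ) (ha : Tendsto (fun n : ℕ => (n : ℝ) * P.real {ω | a n < ‖X 0 ω‖}) atTop (𝓝 1))
    (m : ℕ → ℕ) (hm : Tendsto m atTop atTop)
    (hmn : Tendsto (fun n : ℕ => (m n : ℝ) / (n : ℝ)) atTop (𝓝 0))
    (hmix : MixingCondition P X a m) (hac : AntiClustering P X a m) :
    (∃ Q : Measure (ℤ → EuclideanSpace ℝ (Fin d)), IsSpectralTailLaw P X Q) ∧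
    ∃ (Ω' : Type) (_ : MeasurableSpace Ω') (P' : Measure Ω') (_ : IsProbabilityMeasure P')
      (N : Ω' → PointMeasure (Punctured d)),
      TendstoInDistribution (fun n : ℕ => pointProcess X (a n) n) atTop N (fun _ => P) P' ∧
      ∀ Q : Measure (ℤ → EuclideanSpace ℝ (Fin d)), IsSpectralTailLaw P X Q →
        ∀ g : C_c(Punctured d, ℝ≥0),
          IntegrableOn (clusterIntegrand α Q g) (Ioi 0) ∧
          laplace P' N g = Real.exp (-∫ y in Ioi (0 : ℝ), clusterIntegrand α Q g y) := by
  obtain ⟨Q₀, hQ₀⟩ := exists_isSpectralTailLaw hα hX hstat hRV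
  refine ⟨⟨Q₀, hQ₀⟩, ?_⟩
  have hmeas : ∀ n, Measurable (pointProcess X (a n) n) := fun n => measurable_pointProcess hX _ _
  let μ : ℕ → ProbabilityMeasure (PointMeasure (Punctured d)) := fun n =>
    ⟨P.map (pointProcess X (a n) n), Measure.isProbabilityMeasure_map (hmeas n).aemeasurable⟩
  have hL : ∀ n g, ∫ N, expNegIntegral g N ∂(μ n : Measure (PointMeasure (Punctured d))) =
      laplace P (pointProcess X (a n) n) g := fun n g =>
    integral_map (hmeas n).aemeasurable
      (expNegIntegral g).continuous.measurable.aestronglyMeasurable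
  obtain ⟨ν, hν, hνL⟩ := exists_tendsto_of_tendsto_laplace (μ := μ)
    (L := fun g => Real.exp (-∫ y in Ioi 0, clusterIntegrand α Q₀ g y))
    (fun g => by
      obtain ⟨C, hC⟩ := exists_lintegral_pointProcess_le hX hstat hRV ha g
      refine ⟨C, fun n => le_trans (le_of_eq ?_) (hC n)⟩
      exact lintegral_map (PointMeasure.continuous_integral g).measurable (hmeas n))
    fun g => by
      simp only [hL]
      exact hQ₀.tendsto_laplace hα hX hstat hRV ha hm hmn hmix hac g
  refine ⟨PointMeasure (Punctured d), inferInstance, ν, inferInstance, id,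
    ⟨fun n => (hmeas n).aemeasurable, aemeasurable_id, ?_⟩, fun Q hQ g => ?_⟩
  · have h : (⟨(ν : Measure (PointMeasure (Punctured d))).map id,
        Measure.isProbabilityMeasure_map aemeasurable_id⟩ :
          ProbabilityMeasure (PointMeasure (Punctured d))) = ν := Subtype.ext Measure.map_id
    rw [h]
    exact hν
  · have := hQ.1
    refine ⟨integrableOn_clusterIntegrand hα (hQ.ae_norm_eq_one hX) g, ?_⟩
    -- Two spectral tail laws give the same limit of the Laplace functionals.
    have h1 := tendsto_nhds_unique
      (hQ₀.tendsto_laplace hα hX hstat hRV ha hm hmn hmix hac g)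
      (hQ.tendsto_laplace hα hX hstat hRV ha hm hmn hmix hac g)
    rw [← h1]
    exact hνL g
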